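/- Let $K\le L$ be nonnegative integers and $\mathcal D=[L]$ a set of items. For steps $t=1,\dots,n$ let $\alpha_t\in[0,1]^L$, and let the attraction indicators $A_t(a)$ ($1\le t\le n$, $a\in\mathcal D$) be mutually independent Bernoulli variables with means $\alpha_t(a)$. Let $\Upsilon_n=\#\{2\le t\le n:\alpha_t\ne\alpha_{t-1}\}$ be the number of breakpoints. At step $t$ an agent shows a ranked list $R_t$ of $K$ distinct items, and the user clicks on the first attractive item; the agent observes only the click position $c_t=\min(\{i\le K: A_t(R_t(i))=1\}\cup\{K+1\})$. Put $r(R,w)=1-\prod_{i=1}^K(1-w(R(i)))$. The expected regret is $R(n)=\sum_{t=1}^n\mathbb E[\max_R r(R,\alpha_t)-r(R_t,A_t)]$. CascadeDUCB with parameters $\varepsilon,\gamma$ keeps statistics $N(a),X(a)$, initially $0$. At step $t$ it computes $$U_t(a)=\frac{X(a)}{N(a)}+2\sqrt{\frac{\varepsilon\ln N_t(\gamma)}{N(a)}},\qquad N_t(\gamma)=\frac{1-\gamma^t}{1-\gamma},$$ from the statistics of the first $t-1$ steps, with the convention $x/0:=1$. It shows $K$ items with the largest values of $U_t$ (ties,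 and the order within the list, are resolved by an arbitrary rule depending on the history). It then multiplies all $N(a),X(a)$ by $\gamma$, adds $1$ to $N(R_t(i))$ for each $i\le\min\{c_t,K\}$, and adds $1$ to $X(R_t(c_t))$ if $c_t\le K$. For every $t\le n$ let $\mathcal D_t^*$ be a set of $K$ most attractive items (those with largest $\alpha_t$), and let $\Delta_{a,K}=\min\{\alpha_t(a^*)-\alpha_t(a): t\in[n],\ a\notin\mathcal D_t^*,\ a^*\in\mathcal D_t^*\}\in[0,\infty]$ (the minimum is $\infty$ when there is no such $t$ or $a^*$; $1/\infty=0$, $1/0=\infty$, $0\cdot\infty=0$). **Theorem.** Let $\varepsilon\in(1/2,1)$. (i) For every $\gamma\in(1/2,1)$, the expected $n$-step regret of CascadeDUCB satisfies $$R(n)\le L\,\Upsilon_n\frac{\ln[(1-\gamma)\varepsilon]}{\ln\gamma}+\sum_{a\in\mathcal D}C(\gamma,a)\,\lceil n(1-\gamma)\rceil\,\ln\frac1{1-\gamma},$$ where $$C(\gamma,a)=\frac{4}{1-1/e}\ln\!\Big(1+4\sqrt{1-\tfrac1{2\varepsilon}}\Big)+\frac{32\,\varepsilon}{\Delta_{a,K}\,\gamma^{1/(1-\gamma)}}.$$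 (ii) If $\Upsilon_n\ge1$ and $\gamma=1-\frac14\sqrt{\Upsilon_n/n}$, then $R(n)=O(\sqrt{n\Upsilon_n}\,\ln n)$: for every $\delta>0$ there is a constant $c$ depending only on $L,K,\varepsilon,\delta$ such that $R(n)\le c\sqrt{n\Upsilon_n}\ln n$ for every $n$ and every such environment with $\Upsilon_n\ge 1$ and $\Delta_{a,K}\ge\delta$ for all $a$. -/

import Mathlib

open MeasureTheory ProbabilityTheory
open scoped ENNReal

universe u

noncomputable section

namespace CascadeBandit

/-- A ranked list of `K` distinct items from `Fin L`; position `i : Fin K` is the `(i+1)`-st. -/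
abbrev RankedList (L K : ℕ) : Type := Fin K ↪ Fin L

/-- `S` consists of `K` items with the largest values of `u` (ties broken in any way). -/
def IsTopK {L : ℕ} (K : ℕ) (u : Fin L → ℝ) (S : Finset (Fin L)) : Prop :=
  S.card = K ∧ ∀ a ∈ S, ∀ b ∉ S, u b ≤ u a

/-- The reward `r(R, w) = 1 - ∏ i, (1 - w (R i))`. -/
def reward {L K : ℕ} (R : RankedList L K) (w : Fin L → ℝ) : ℝ :=
  1 - ∏ i, (1 - w (R i))

/-- Attraction indicators as a `0/1` valued vector. -/
def toReal {L : ℕ} (A : Fin L → Bool) (a : Fin L) : ℝ := if A a = true then 1 else 0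

/-- The click in the cascade model: the (1-based) position of the first attractive item of the
list, and `K + 1` if no item of the list is attractive. -/
def click {L K : ℕ} (R : RankedList L K) (A : Fin L → Bool) : ℕ :=
  sInf ({j : ℕ | ∃ i : Fin K, i.val + 1 = j ∧ A (R i) = true} ∪ {K + 1})

/-- What the agent has seen so far, most recent step first: displayed lists with the
(1-based) click positions. -/
abbrev History (L K : ℕ) : Type := List (RankedList L K × ℕ)

open Classical in
/-- Discounted number of times that an item was examined (shown at a position `≤` the click). -/
def discN {L K : ℕ} (γ : ℝ) : History L K → Fin L → ℝ
  | [], _ => 0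
  | (R, c) :: h, a => γ * discN γ h a + if ∃ i : Fin K, R i = a ∧ i.val + 1 ≤ c then 1 else 0

open Classical in
/-- Discounted number of times that an item was clicked. -/
def discX {L K : ℕ} (γ : ℝ) : History L K → Fin L → ℝ
  | [], _ => 0
  | (R, c) :: h, a => γ * discX γ h a + if ∃ i : Fin K, R i = a ∧ i.val + 1 = c then 1 else 0

/-- The discounted time horizon `N_t(γ)`. -/
def horizon (γ : ℝ) (t : ℕ) : ℝ := (1 - γ ^ t) / (1 - γ)

open Classical in
/-- Division with the convention `x / 0 = 1`. -/
def divOne (x y : ℝ) : ℝ := if y = 0 then 1 else x / y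

/-- The upper confidence bound of an item at step `t = h.length + 1`, given the history `h` of the
first `t - 1` steps: discounted click rate plus confidence radius. -/
def ucb {L K : ℕ} (γ ε : ℝ) (h : History L K) (a : Fin L) : ℝ :=
  divOne (discX γ h a) (discN γ h a) +
    2 * √(divOne (ε * Real.log (horizon γ (h.length + 1))) (discN γ h a))

/-- A policy maps the history to the next list. It is a CascadeDUCB policy if the list always
consists of `K` items with the largest upper confidence bounds; ties, and the order within the
list, may be resolved in any way depending on the history. -/
def IsCascadeDUCB {L K : ℕ} (γ ε : ℝ) (π : History L K → RankedList L K) : Prop :=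
  ∀ h : History L K, IsTopK K (ucb γ ε h) (Finset.univ.map (π h))

/-- The history after `t` steps when the attraction indicators at steps `1, 2, …` are
`A 1, A 2, …`. -/
def hist {L K : ℕ} (π : History L K → RankedList L K) (A : ℕ → Fin L → Bool) : ℕ → History L K
  | 0 => []
  | t + 1 => (π (hist π A t), click (π (hist π A t)) (A (t + 1))) :: hist π A t

/-- The list displayed at step `t ≥ 1`. -/
def shown {L K : ℕ} (π : History L K → RankedList L K) (A : ℕ → Fin L → Bool) (t : ℕ) :
    RankedList L K :=
  π (hist π A (t - 1))

/-- The attraction indicators `A t · a`, for steps `1 ≤ t ≤ n` and items `a`, are mutually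
independent Bernoulli variables with means `α t a`. -/
structure IsEnvironment {Ω : Type u} [MeasurableSpace Ω] (μ : Measure Ω) {L : ℕ} (n : ℕ)
    (α : ℕ → Fin L → ℝ) (A : ℕ → Ω → Fin L → Bool) : Prop where
  measurable : ∀ t ∈ Finset.Icc 1 n, ∀ a, Measurable fun ω => A t ω a
  law : ∀ t ∈ Finset.Icc 1 n, ∀ a, μ.real {ω | A t ω a = true} = α t a
  indep : iIndepFun (fun (p : ↥(Finset.Icc 1 n) × Fin L) (ω : Ω) => A p.1 ω p.2) μ

open Classical in
/-- The number of breakpoints: steps `2 ≤ t ≤ n` at which the attraction probabilities change. -/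
def numBreaks {L : ℕ} (α : ℕ → Fin L → ℝ) (n : ℕ) : ℕ :=
  ((Finset.Icc 2 n).filter fun t => α t ≠ α (t - 1)).card

/-- The expected `n`-step regret of a policy. -/
def regret {Ω : Type u} [MeasurableSpace Ω] (μ : Measure Ω) {L K : ℕ} (α : ℕ → Fin L → ℝ)
    (A : ℕ → Ω → Fin L → Bool) (π : History L K → RankedList L K) (n : ℕ) : ℝ :=
  ∑ t ∈ Finset.Icc 1 n,
    ∫ ω, ((⨆ R : RankedList L K, reward R (α t)) -
      reward (shown π (fun s => A s ω) t) (toReal (A t ω))) ∂μ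

/-- The gap `Δ_{a,K}`: the smallest difference between the attraction probabilities of an optimal
item and of `a`, over all steps `1 ≤ t ≤ n` at which `a` is not among the `K` optimal items
`D t`. It is `∞` for an item that is optimal at all steps. -/
def gap {L : ℕ} (α : ℕ → Fin L → ℝ) (D : ℕ → Finset (Fin L)) (n : ℕ) (a : Fin L) : ℝ≥0∞ :=
  ⨅ t ∈ Finset.Icc 1 n, ⨅ (_ : a ∉ D t), ⨅ b ∈ D t, ENNReal.ofReal (α t b - α t a)

/-- The constant `C(γ, a)` for an item with gap `Δ`; `1 / 0 = ∞` and `1 / ∞ = 0`. -/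
def constC (ε γ : ℝ) (Δ : ℝ≥0∞) : ℝ≥0∞ :=
  ENNReal.ofReal (4 / (1 - 1 / Real.exp 1) * Real.log (1 + 4 * √(1 - 1 / (2 * ε)))) +
    ENNReal.ofReal (32 * ε) / (Δ * ENNReal.ofReal (γ ^ (1 / (1 - γ))))

end CascadeBandit

end

/-! Write `x = 1-γ`, `l = ln(1/x)`, `c = γ^(1/x)`, `Y = 16εl`. Every step costs at most `1` in
expectation, so the steps less than `W` after a breakpoint cost at most `Υ_n W` together; `W = ⌊2
ln(xε)/ln γ⌋` gives the first term of the bound, since `0 < K < L` forces `L ≥ 2`. At the other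
steps, observations older than `W` steps have discounted weight at most `ε/6`, so the bias takes up
only a fixed fraction of the confidence radius (`RadiusFails.deviation`). An exponential
supermartingale (`integral_exp_le_one`), peeled over the random size of `N(a)`
(`integral_deviation_le`), shows that the radius of an item fails with probability at most
`4/N_t(γ)`. The loss of a list is charged to examined suboptimal items and to failed radii
(`prod_list_sub_prod_le`). Without failures, the gap `g` charged to a displayed suboptimal item `a`
satisfies `g² N(a) ≤ Y`, so an examination costs at most `min(1, √(Y/N(a)))`, and nothing once this
is below `Δ`. In a block of about `1/x` steps, an examination preceded by `j` others finds `N(a) ≥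
jc`, and summing over `j` gives at most `2Y/(cΔ) - Y/c + 2` per block (`sum_cutCap_le`). Here
`2Y/(cΔ)` yields the second summand of `C(γ,a)`, and `-Y/c`, which comes from the cap at `1`, pays
for all failures; the logarithmic summand of `C(γ,a)` is not needed. The constants work for `γ ≥
99/100`; for smaller `γ` the trivial bound `R(n) ≤ n` lies below the contribution of a single item.
Part (ii) substitutes the given `γ` into the same estimate. -/

namespace CascadeBandit

/-! ### One step of the cascade model: products of Bernoulli laws, examinations and clicks. -/

section

/-- Probability of the outcome `v` of independent Bernoulli variables with means `p`. -/
noncomputable def bernWeight {ι : Type*} [Fintype ι] (p : ι → ℝ) (v : ι → Bool) : ℝ :=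
  ∏ a, if v a = true then p a else 1 - p a

theorem sum_bernWeight_mul_prod {ι : Type*} [Fintype ι] [DecidableEq ι] (p : ι → ℝ)
    (f : ι → Bool → ℝ) :
    ∑ v, bernWeight p v * ∏ a, f a (v a) = ∏ a, (p a * f a true + (1 - p a) * f a false) := by
  have h : ∀ a, p a * f a true + (1 - p a) * f a false =
      ∑ b : Bool, (if b = true then p a else 1 - p a) * f a b := by
    intro a; simp
  simp_rw [h, Finset.prod_univ_sum, Fintype.piFinset_univ, bernWeight, Finset.prod_mul_distrib]

theorem sum_bernWeight {ι : Type*} [Fintype ι] [DecidableEq ι] (p : ι → ℝ) :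
    ∑ v, bernWeight p v = 1 := by
  simpa using sum_bernWeight_mul_prod p (fun _ _ => 1)

theorem bernWeight_nonneg {ι : Type*} [Fintype ι] {p : ι → ℝ} (hp : ∀ a, 0 ≤ p a ∧ p a ≤ 1)
    (v : ι → Bool) : 0 ≤ bernWeight p v := by
  refine Finset.prod_nonneg fun a _ => ?_
  split_ifs
  · exact (hp a).1
  · linarith [(hp a).2]

variable {L K : ℕ}

theorem le_click_iff (R : RankedList L K) (v : Fin L → Bool) (i : Fin K) :
    i.val + 1 ≤ click R v ↔ ∀ j < i, v (R j) = false := by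
  unfold click
  rw [le_csInf_iff'' ⟨K + 1, by simp⟩]
  constructor
  · intro h j hj
    by_contra hv
    have := h (j.val + 1) (Or.inl ⟨j, rfl, by simpa using hv⟩)
    have hj' : j.val < i.val := hj
    omega
  · rintro h b (⟨j, rfl, hj⟩ | hb)
    · by_contra hlt
      have : j < i := by rw [Fin.lt_def]; omega
      simp [h j this] at hj
    · have := i.2
      simp only [Set.mem_singleton_iff] at hb
      omega

theorem click_mem (R : RankedList L K) (v : Fin L → Bool) :
    click R v ∈ ({j : ℕ | ∃ i : Fin K, i.val + 1 = j ∧ v (R i) = true} ∪ {K + 1} : Set ℕ) :=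
  Nat.sInf_mem ⟨K + 1, by simp⟩

theorem click_eq_iff (R : RankedList L K) (v : Fin L → Bool) (i : Fin K) :
    i.val + 1 = click R v ↔ (∀ j < i, v (R j) = false) ∧ v (R i) = true := by
  constructor
  · intro h
    refine ⟨(le_click_iff R v i).1 h.le, ?_⟩
    rcases click_mem R v with ⟨j, hj, hv⟩ | hb
    · have : j = i := Fin.ext (by omega)
      rwa [← this]
    · have := i.2
      simp only [Set.mem_singleton_iff] at hb
      omega
  · rintro ⟨h1, h2⟩
    refine le_antisymm ((le_click_iff R v i).2 h1) ?_
    exact Nat.sInf_le (Or.inl ⟨i, rfl, h2⟩)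

open Classical in
/-- Indicator that item `a` of the list `R` is examined when the click is at position `c`. -/
noncomputable def examInd (R : RankedList L K) (c : ℕ) (a : Fin L) : ℝ :=
  if ∃ i : Fin K, R i = a ∧ i.val + 1 ≤ c then 1 else 0

open Classical in
/-- Indicator that item `a` of the list `R` is clicked when the click is at position `c`. -/
noncomputable def clickInd (R : RankedList L K) (c : ℕ) (a : Fin L) : ℝ :=
  if ∃ i : Fin K, R i = a ∧ i.val + 1 = c then 1 else 0

theorem exists_position_iff (R : RankedList L K) (P : ℕ → Prop) (i : Fin K) :
    (∃ j : Fin K, R j = R i ∧ P j.val) ↔ P i.val := by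
  constructor
  · rintro ⟨j, hj, h⟩
    rwa [← R.injective hj]
  · exact fun h => ⟨i, rfl, h⟩

theorem examInd_apply (R : RankedList L K) (v : Fin L → Bool) (i : Fin K) :
    examInd R (click R v) (R i) = ∏ j with j < i, (if v (R j) = true then (0 : ℝ) else 1) := by
  unfold examInd
  have h := exists_position_iff R (fun k => k + 1 ≤ click R v) i
  rw [if_congr h rfl rfl, if_congr (le_click_iff R v i) rfl rfl]
  split_ifs with h
  · exact (Finset.prod_eq_one fun j hj => by simp [h j (by simpa using hj)]).symm
  · push Not at h
    obtain ⟨j, hj, hv⟩ := h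
    exact (Finset.prod_eq_zero (i := j) (by simpa using hj) (by simpa using hv)).symm

theorem clickInd_apply (R : RankedList L K) (v : Fin L → Bool) (i : Fin K) :
    clickInd R (click R v) (R i) =
      examInd R (click R v) (R i) * if v (R i) = true then 1 else 0 := by
  unfold clickInd examInd
  have h := exists_position_iff R (fun k => k + 1 ≤ click R v) i
  have h' := exists_position_iff R (fun k => k + 1 = click R v) i
  rw [if_congr h rfl rfl, if_congr h' rfl rfl, if_congr (le_click_iff R v i) rfl rfl,
    if_congr (click_eq_iff R v i) rfl rfl]
  split_ifs <;> simp_all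

theorem examInd_of_notMem (R : RankedList L K) (c : ℕ) {a : Fin L} (ha : ∀ i, R i ≠ a) :
    examInd R c a = 0 := by
  simp [examInd, ha]

theorem clickInd_of_notMem (R : RankedList L K) (c : ℕ) {a : Fin L} (ha : ∀ i, R i ≠ a) :
    clickInd R c a = 0 := by
  simp [clickInd, ha]

theorem examInd_eq_zero_or_one (R : RankedList L K) (c : ℕ) (a : Fin L) :
    examInd R c a = 0 ∨ examInd R c a = 1 := by
  unfold examInd; split_ifs <;> simp

theorem examInd_nonneg (R : RankedList L K) (c : ℕ) (a : Fin L) : 0 ≤ examInd R c a := by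
  rcases examInd_eq_zero_or_one R c a with h | h <;> simp [h]

theorem examInd_le_one (R : RankedList L K) (c : ℕ) (a : Fin L) : examInd R c a ≤ 1 := by
  rcases examInd_eq_zero_or_one R c a with h | h <;> simp [h]

theorem prod_eq_mul_prod_earlier (R : RankedList L K) (i : Fin K) (G : Fin L → ℝ)
    (h1 : ∀ a, (∀ j ≤ i, R j ≠ a) → G a = 1) :
    ∏ a, G a = G (R i) * ∏ j with j < i, G (R j) := by
  classical
  rw [← Finset.prod_subset (Finset.subset_univ ((insert i (Finset.univ.filter (· < i))).map R)),
    Finset.prod_map, Finset.prod_insert (by simp)]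
  intro a _ ha
  refine h1 a fun j hj hja => ha (Finset.mem_map.2 ⟨j, ?_, hja⟩)
  rcases hj.eq_or_lt with rfl | h <;> simp [*]

/-- Whether position `i` is examined depends only on the items placed before it, so the attraction
of `R i` is independent of its examination. Cascade feedback is therefore unbiased. -/
theorem sum_bernWeight_examInd_mul (p : Fin L → ℝ) (R : RankedList L K) (i : Fin K)
    (g : Bool → ℝ) :
    ∑ v, bernWeight p v * (examInd R (click R v) (R i) * g (v (R i))) =
      (∏ j with j < i, (1 - p (R j))) * (p (R i) * g true + (1 - p (R i)) * g false) := by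
  classical
  let f : Fin L → Bool → ℝ := fun a b =>
    if a = R i then g b else if ∃ j < i, R j = a then (if b = true then 0 else 1) else 1
  have hfi : f (R i) = g := by ext b; simp [f]
  have hfj : ∀ j < i, f (R j) = fun b => if b = true then 0 else 1 := by
    intro j hj
    ext b
    have h2 : ∃ k < i, R k = R j := ⟨j, hj, rfl⟩
    simp only [f, if_neg (R.injective.ne hj.ne), if_pos h2]
  have hf1 : ∀ a, (∀ j ≤ i, R j ≠ a) → f a = fun _ => 1 := by
    intro a ha
    ext b
    have h2 : ¬ ∃ k < i, R k = a := fun ⟨k, hk, h⟩ => ha k hk.le h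
    simp only [f, if_neg (ha i le_rfl).symm, if_neg h2]
  have h1 : ∀ v : Fin L → Bool,
      examInd R (click R v) (R i) * g (v (R i)) = ∏ a, f a (v a) := by
    intro v
    rw [prod_eq_mul_prod_earlier R i (fun a => f a (v a)) (fun a ha => by simp [hf1 a ha]),
      examInd_apply, mul_comm, hfi]
    congr 1
    exact Finset.prod_congr rfl fun j hj => by simp [hfj j (by simpa using hj)]
  simp_rw [h1]
  rw [sum_bernWeight_mul_prod, prod_eq_mul_prod_earlier R i _ (fun a ha => by simp [hf1 a ha]),
    hfi, mul_comm]
  congr 1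
  exact Finset.prod_congr rfl fun j hj => by simp [hfj j (by simpa using hj)]

theorem sum_bernWeight_examInd (p : Fin L → ℝ) (R : RankedList L K) (i : Fin K) :
    ∑ v, bernWeight p v * examInd R (click R v) (R i) = ∏ j with j < i, (1 - p (R j)) := by
  simpa using sum_bernWeight_examInd_mul p R i (fun _ => 1)

theorem sum_bernWeight_prod_list (p : Fin L → ℝ) (R : RankedList L K) :
    ∑ v, bernWeight p v * ∏ i, (1 - toReal v (R i)) = ∏ i, (1 - p (R i)) := by
  classical
  have hprod : ∀ G : Fin L → ℝ, ∏ i, G (R i) = ∏ a, if ∃ i, R i = a then G a else 1 := by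
    intro G
    rw [← Finset.prod_filter, ← Finset.prod_map Finset.univ R G]
    congr 1
    ext a
    simp
  let f : Fin L → Bool → ℝ := fun a b => if ∃ i, R i = a then (if b = true then 0 else 1) else 1
  have h1 : ∀ v : Fin L → Bool, ∏ i, (1 - toReal v (R i)) = ∏ a, f a (v a) := by
    intro v
    rw [hprod fun a => 1 - toReal v a]
    refine Finset.prod_congr rfl fun a _ => ?_
    simp only [f, toReal]
    split_ifs <;> simp
  simp_rw [h1]
  rw [sum_bernWeight_mul_prod, hprod fun a => 1 - p a]
  refine Finset.prod_congr rfl fun a _ => ?_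
  by_cases h : ∃ i, R i = a
  · simp only [f, if_pos h]
    simp
  · simp only [f, if_neg h]
    simp

/-- Hoeffding's lemma for a Bernoulli variable. -/
theorem bernoulli_mgf_le {p : ℝ} (hp : 0 ≤ p ∧ p ≤ 1) (t : ℝ) :
    p * Real.exp (t * (1 - p)) + (1 - p) * Real.exp (t * (0 - p)) ≤ Real.exp (t ^ 2 / 8) := by
  -- The two-point law, so that the sub-Gaussian bound for variables in `[0,1]` applies; its
  -- variance proxy `1/4` gives `t²/8`.
  let μ : Measure Bool := ENNReal.ofReal p • Measure.dirac true +
    ENNReal.ofReal (1 - p) • Measure.dirac false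
  have hμ : IsProbabilityMeasure μ := ⟨by
    simp only [μ, Measure.add_apply, Measure.smul_apply, measure_univ, smul_eq_mul, mul_one]
    rw [← ENNReal.ofReal_add hp.1 (by linarith [hp.2])]
    simp⟩
  have hint : ∀ f : Bool → ℝ, ∫ b, f b ∂μ = p * f true + (1 - p) * f false := by
    intro f
    have hfin : ∀ (r : ℝ) (b : Bool), IsFiniteMeasure (ENNReal.ofReal r • Measure.dirac b) :=
      fun r b => ⟨by simp⟩
    have hp1 := hfin p true
    have hp2 := hfin (1 - p) false
    rw [integral_add_measure .of_finite .of_finite, integral_smul_measure, integral_smul_measure,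
      integral_dirac, integral_dirac, ENNReal.toReal_ofReal hp.1,
      ENNReal.toReal_ofReal (by linarith [hp.2])]
    simp
  have h := hasSubgaussianMGF_of_mem_Icc (μ := μ) (a := 0) (b := 1)
    (X := fun b : Bool => if b = true then (1 : ℝ) else 0)
    (measurable_of_countable _).aemeasurable
    (Filter.Eventually.of_forall fun b => by cases b <;> simp)
  have h2 := h.mgf_le t
  simp only [mgf, hint] at h2
  refine le_trans (le_of_eq ?_) (h2.trans (le_of_eq ?_))
  · simp
  · congr 1
    norm_num
    ring

/-- Without an examination the exponent is `0`; with one, Hoeffding's lemma applies to the still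
independent attraction. This is the one-step supermartingale inequality. -/
theorem sum_bernWeight_exp_le_one {p : Fin L → ℝ} (hp : ∀ a, 0 ≤ p a ∧ p a ≤ 1)
    (R : RankedList L K) (a : Fin L) (t : ℝ) :
    ∑ v, bernWeight p v * Real.exp (t * (clickInd R (click R v) a - p a * examInd R (click R v) a)
      - t ^ 2 / 8 * examInd R (click R v) a) ≤ 1 := by
  by_cases ha : ∃ i, R i = a
  · obtain ⟨i, rfl⟩ := ha
    let g : Bool → ℝ := fun b =>
      Real.exp (t * ((if b = true then 1 else 0) - p (R i)) - t ^ 2 / 8) - 1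
    have h1 : ∀ v : Fin L → Bool, Real.exp (t * (clickInd R (click R v) (R i) -
        p (R i) * examInd R (click R v) (R i)) - t ^ 2 / 8 * examInd R (click R v) (R i)) =
        1 + examInd R (click R v) (R i) * g (v (R i)) := by
      intro v
      rw [clickInd_apply]
      rcases examInd_eq_zero_or_one R (click R v) (R i) with h | h <;> simp [h, g]
    simp_rw [h1, mul_add, Finset.sum_add_distrib, sum_bernWeight_examInd_mul, mul_one,
      sum_bernWeight]
    have h2 : 0 ≤ ∏ j with j < i, (1 - p (R j)) :=
      Finset.prod_nonneg fun j _ => by linarith [(hp (R j)).2]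
    have h3 : p (R i) * g true + (1 - p (R i)) * g false ≤ 0 := by
      have h4 := bernoulli_mgf_le (hp (R i)) t
      have h5 : p (R i) * g true + (1 - p (R i)) * g false =
          (p (R i) * Real.exp (t * (1 - p (R i))) + (1 - p (R i)) * Real.exp (t * (0 - p (R i)))) *
            Real.exp (-(t ^ 2 / 8)) - 1 := by
        simp only [g, sub_eq_add_neg, Real.exp_add]
        simp
        ring
      rw [h5]
      have h6 := mul_le_mul_of_nonneg_right h4 (Real.exp_pos (-(t ^ 2 / 8))).le
      rw [← Real.exp_add, add_neg_cancel, Real.exp_zero] at h6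
      linarith
    nlinarith [mul_nonneg h2 (neg_nonneg.2 h3)]
  · push Not at ha
    simp [examInd_of_notMem R _ ha, clickInd_of_notMem R _ ha, sum_bernWeight]

end

/-! ### Measurability, and independence of the past from the current step. -/

section

variable {L K : ℕ}

theorem hist_congr (π : History L K → RankedList L K) {A A' : ℕ → Fin L → Bool} {t : ℕ}
    (h : ∀ s ∈ Finset.Icc 1 t, A s = A' s) : hist π A t = hist π A' t := by
  induction t with
  | zero => rfl
  | succ t ih =>
    have h1 := ih fun s hs => h s (by simp only [Finset.mem_Icc] at hs ⊢; omega)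
    simp only [hist, h1, h (t + 1) (by simp)]

theorem length_hist (π : History L K → RankedList L K) (A : ℕ → Fin L → Bool) (t : ℕ) :
    (hist π A t).length = t := by
  induction t with
  | zero => rfl
  | succ t ih => simp [hist, ih]

variable {Ω : Type u} {n : ℕ} {A : ℕ → Ω → Fin L → Bool}

open Classical in
/-- Indicators at steps `1, …, n`, extended by `false` to all steps. -/
noncomputable def extendPath (s : Finset (↥(Finset.Icc 1 n) × Fin L)) (u : s → Bool) (t : ℕ)
    (a : Fin L) : Bool :=
  if h : ∃ ht : t ∈ Finset.Icc 1 n, (⟨t, ht⟩, a) ∈ s then u ⟨(⟨t, h.1⟩, a), h.2⟩ else false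

theorem extendPath_apply {s : Finset (↥(Finset.Icc 1 n) × Fin L)} (ω : Ω) {t : ℕ} {a : Fin L}
    (ht : t ∈ Finset.Icc 1 n) (hs : (⟨t, ht⟩, a) ∈ s) :
    extendPath s (fun p => A p.1.1 ω p.1.2) t a = A t ω a := by
  have h : ∃ ht : t ∈ Finset.Icc 1 n, (⟨t, ht⟩, a) ∈ s := ⟨ht, hs⟩
  exact dif_pos h

variable [MeasurableSpace Ω] {μ : Measure Ω} {α : ℕ → Fin L → ℝ}

/-- `F` factors through finitely many Boolean variables, that is, through a finite discrete space on
which every function is integrable. -/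
theorem IsEnvironment.integrable [IsProbabilityMeasure μ] (hA : IsEnvironment μ n α A)
    {F : (ℕ → Fin L → Bool) → ℝ}
    (hF : ∀ B B' : ℕ → Fin L → Bool, (∀ s ∈ Finset.Icc 1 n, B s = B' s) → F B = F B') :
    Integrable (fun ω => F fun s => A s ω) μ := by
  classical
  have h1 : (fun ω => F fun s => A s ω) =
      (fun u => F (extendPath Finset.univ u)) ∘
        (fun ω (p : (Finset.univ : Finset (↥(Finset.Icc 1 n) × Fin L))) => A p.1.1 ω p.1.2) := by
    ext ω
    refine hF _ _ fun s hs => ?_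
    ext a
    rw [extendPath_apply ω hs (Finset.mem_univ _)]
  have h2 : Measurable (fun ω (p : (Finset.univ : Finset (↥(Finset.Icc 1 n) × Fin L))) =>
      A p.1.1 ω p.1.2) :=
    measurable_pi_lambda _ fun p => hA.measurable _ p.1.1.2 _
  rw [h1]
  refine Integrable.comp_measurable ?_ h2
  exact .of_finite

theorem IsEnvironment.mem_unitInterval [IsProbabilityMeasure μ] (hA : IsEnvironment μ n α A) {t : ℕ}
    (ht : t ∈ Finset.Icc 1 n) (a : Fin L) : 0 ≤ α t a ∧ α t a ≤ 1 := by
  rw [← hA.law t ht a]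
  exact ⟨measureReal_nonneg, measureReal_le_one⟩

theorem IsEnvironment.measureReal_eq_bernWeight [IsProbabilityMeasure μ]
    (hA : IsEnvironment μ n α A) {t : ℕ} (ht : t ∈ Finset.Icc 1 n) (v : Fin L → Bool) :
    μ.real {ω | A t ω = v} = bernWeight (α t) v := by
  classical
  have h := hA.indep.measure_inter_preimage_eq_mul
    (Finset.univ.map ⟨fun a : Fin L => ((⟨t, ht⟩, a) : ↥(Finset.Icc 1 n) × Fin L),
      fun a b h => (Prod.mk.inj h).2⟩) (sets := fun p => {v p.2})
    (fun _ _ => MeasurableSet.of_discrete)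
  have h1 : {ω | A t ω = v} = ⋂ a : Fin L, (fun ω => A t ω a) ⁻¹' {v a} := by
    ext ω; simp [funext_iff]
  have h2 : ∀ a, μ.real ((fun ω => A t ω a) ⁻¹' {v a}) =
      if v a = true then α t a else 1 - α t a := by
    intro a
    have h3 : MeasurableSet {ω | A t ω a = true} := hA.measurable t ht a (MeasurableSet.singleton true)
    split_ifs with hv
    · rw [← hA.law t ht a, hv]; rfl
    · rw [← hA.law t ht a, ← probReal_compl_eq_one_sub h3]
      congr 1
      ext ω
      simp [hv]
  rw [Finset.prod_map] at h
  simp only [Finset.mem_map, Finset.mem_univ, true_and,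
    Set.iInter_exists, Set.iInter_iInter_eq'] at h
  rw [bernWeight, h1, Measure.real]
  refine (congrArg ENNReal.toReal h).trans ?_
  rw [ENNReal.toReal_prod]
  exact Finset.prod_congr rfl fun a _ => h2 a

/-- Conditioning on the past without conditional expectations: the history is a function of earlier
indicators, so the current ones may be averaged out under their product law. -/
theorem IsEnvironment.integral_step [IsProbabilityMeasure μ] (hA : IsEnvironment μ n α A)
    (π : History L K → RankedList L K) {t : ℕ} (ht : t + 1 ≤ n)
    (G : History L K → (Fin L → Bool) → ℝ) :
    ∫ ω, G (hist π (fun s => A s ω) t) (A (t + 1) ω) ∂μ =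
      ∫ ω, ∑ v, bernWeight (α (t + 1)) v * G (hist π (fun s => A s ω) t) v ∂μ := by
  classical
  have ht' : t + 1 ∈ Finset.Icc 1 n := by simp [ht]
  have hint : ∀ v, Integrable (fun ω => G (hist π (fun s => A s ω) t) v) μ := fun v =>
    hA.integrable (F := fun B => G (hist π B t) v) fun B B' h => by
      rw [hist_congr π fun s hs => h s (by simp only [Finset.mem_Icc] at hs ⊢; omega)]
  have hint2 : ∀ v, Integrable (fun ω => (if A (t + 1) ω = v then (1 : ℝ) else 0) *
      G (hist π (fun s => A s ω) t) v) μ := fun v =>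
    hA.integrable (F := fun B => (if B (t + 1) = v then (1 : ℝ) else 0) * G (hist π B t) v)
      fun B B' h => by
      rw [h _ ht', hist_congr π fun s hs => h s (by simp only [Finset.mem_Icc] at hs ⊢; omega)]
  have h1 : ∀ ω, G (hist π (fun s => A s ω) t) (A (t + 1) ω) =
      ∑ v, (if A (t + 1) ω = v then (1 : ℝ) else 0) * G (hist π (fun s => A s ω) t) v := by
    intro ω; simp
  simp_rw [h1]
  rw [integral_finsetSum _ fun v _ => hint2 v,
    integral_finsetSum _ fun v _ => (hint v).const_mul _]
  refine Finset.sum_congr rfl fun v _ => ?_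
  rw [integral_const_mul]
  -- The indicators of step `t + 1` and those of steps up to `t` are disjoint subfamilies of an
  -- independent family.
  have hind := hA.indep.indepFun_finset
    (Finset.univ.filter fun p : ↥(Finset.Icc 1 n) × Fin L => p.1.1 = t + 1)
    (Finset.univ.filter fun p : ↥(Finset.Icc 1 n) × Fin L => p.1.1 ≤ t)
    (by rw [Finset.disjoint_filter]; intro p _ h; omega)
    (fun p => hA.measurable _ p.1.2 _)
  have hind2 := hind.comp
    (φ := fun u => if extendPath _ u (t + 1) = v then (1 : ℝ) else 0)
    (ψ := fun u => G (hist π (extendPath _ u) t) v)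
    (measurable_of_countable _) (measurable_of_countable _)
  have e1 : ((fun u => if extendPath _ u (t + 1) = v then (1 : ℝ) else 0) ∘
      fun ω (p : (Finset.univ.filter fun p : ↥(Finset.Icc 1 n) × Fin L => p.1.1 = t + 1)) =>
        A p.1.1 ω p.1.2) = fun ω => if A (t + 1) ω = v then (1 : ℝ) else 0 := by
    ext ω
    have : extendPath _ (fun p : (Finset.univ.filter fun p : ↥(Finset.Icc 1 n) × Fin L =>
        p.1.1 = t + 1) => A p.1.1 ω p.1.2) (t + 1) = A (t + 1) ω := by
      ext a
      rw [extendPath_apply ω ht' (by simp)]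
    simp only [Function.comp_apply, this]
  have e2 : ((fun u => G (hist π (extendPath _ u) t) v) ∘
      fun ω (p : (Finset.univ.filter fun p : ↥(Finset.Icc 1 n) × Fin L => p.1.1 ≤ t)) =>
        A p.1.1 ω p.1.2) = fun ω => G (hist π (fun s => A s ω) t) v := by
    ext ω
    simp only [Function.comp_apply]
    congr 1
    refine hist_congr π fun s hs => ?_
    simp only [Finset.mem_Icc] at hs
    ext a
    rw [extendPath_apply ω (by simp only [Finset.mem_Icc]; omega) (by simp [hs.2])]
  rw [e1, e2] at hind2
  have hm : Measurable fun ω => A (t + 1) ω :=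
    measurable_pi_lambda _ fun a => hA.measurable _ ht' a
  have hm1 : Measurable fun ω => if A (t + 1) ω = v then (1 : ℝ) else 0 :=
    (measurable_of_countable fun u : Fin L → Bool => if u = v then (1 : ℝ) else 0).comp hm
  rw [hind2.integral_fun_mul_eq_mul_integral hm1.aestronglyMeasurable (hint v).aestronglyMeasurable]
  congr 1
  rw [← hA.measureReal_eq_bernWeight ht' v, ← integral_indicator_one]
  · congr 1 with ω
    simp [Set.indicator]
  · exact hm (MeasurableSet.singleton v)

end

/-! ### Discounted statistics: bias, exponential moments, and deviations. -/

section

variable {L K : ℕ}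

theorem discN_cons (γ : ℝ) (R : RankedList L K) (c : ℕ) (h : History L K) (a : Fin L) :
    discN γ ((R, c) :: h) a = γ * discN γ h a + examInd R c a := rfl

theorem discX_cons (γ : ℝ) (R : RankedList L K) (c : ℕ) (h : History L K) (a : Fin L) :
    discX γ ((R, c) :: h) a = γ * discX γ h a + clickInd R c a := rfl

/-- Discounted sum of the attraction probabilities of an item over the steps at which it was
examined. -/
noncomputable def discMean (γ : ℝ) (α : ℕ → Fin L → ℝ) : History L K → Fin L → ℝ
  | [], _ => 0
  | (R, c) :: h, a => γ * discMean γ α h a + α (h.length + 1) a * examInd R c a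

theorem discN_nonneg {γ : ℝ} (hγ : 0 ≤ γ) (h : History L K) (a : Fin L) : 0 ≤ discN γ h a := by
  induction h with
  | nil => exact le_rfl
  | cons x h ih =>
    obtain ⟨R, c⟩ := x
    rw [discN_cons]
    have := examInd_nonneg R c a
    positivity

theorem discN_le_horizon {γ : ℝ} (hγ : 0 ≤ γ) (hγ1 : γ < 1) (h : History L K) (a : Fin L) :
    discN γ h a ≤ horizon γ h.length := by
  induction h with
  | nil => simp [discN, horizon]
  | cons x h ih =>
    obtain ⟨R, c⟩ := x
    rw [discN_cons]
    have h1 := examInd_le_one R c a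
    have h2 : horizon γ (h.length + 1) = γ * horizon γ h.length + 1 := by
      have : 1 - γ ≠ 0 := by linarith
      unfold horizon
      field_simp
      ring
    rw [List.length_cons, h2]
    nlinarith

theorem horizon_le {γ : ℝ} (hγ : 0 ≤ γ) (hγ1 : γ < 1) (t : ℕ) : horizon γ t ≤ 1 / (1 - γ) := by
  unfold horizon
  have := pow_nonneg hγ t
  have : 0 < 1 - γ := by linarith
  gcongr
  linarith

theorem abs_clickInd_sub_le (R : RankedList L K) (c : ℕ) (a : Fin L) {p : ℝ} (hp : 0 ≤ p)
    (hp1 : p ≤ 1) : |clickInd R c a - p * examInd R c a| ≤ examInd R c a := by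
  unfold clickInd examInd
  split_ifs with h1 h2 h2
  · rw [abs_le]; constructor <;> linarith
  · obtain ⟨i, h, h'⟩ := h1
    exact absurd ⟨i, h, h'.le⟩ h2
  · rw [abs_le]; constructor <;> linarith
  · simp

theorem abs_discX_sub_discMean_le {γ : ℝ} (hγ : 0 ≤ γ) {α : ℕ → Fin L → ℝ} (h : History L K)
    (a : Fin L) (hα : ∀ s, 1 ≤ s → s ≤ h.length → 0 ≤ α s a ∧ α s a ≤ 1) :
    |discX γ h a - discMean γ α h a| ≤ discN γ h a := by
  induction h with
  | nil => simp [discX, discMean, discN]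
  | cons x h ih =>
    obtain ⟨R, c⟩ := x
    rw [discN_cons, discX_cons, discMean]
    have h1 := ih fun s hs hs' => hα s hs (by simp; omega)
    obtain ⟨h2, h3⟩ := hα (h.length + 1) (by omega) (by simp)
    have h4 := abs_clickInd_sub_le R c a h2 h3
    calc _ = |γ * (discX γ h a - discMean γ α h a) +
          (clickInd R c a - α (h.length + 1) a * examInd R c a)| := by congr 1; ring
      _ ≤ γ * |discX γ h a - discMean γ α h a| + |clickInd R c a - α (h.length + 1) a *
          examInd R c a| := by
        refine (abs_add_le _ _).trans ?_
        rw [abs_mul, abs_of_nonneg hγ]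
      _ ≤ _ := by gcongr

theorem abs_discMean_sub_le {γ : ℝ} (hγ : 0 ≤ γ) {α : ℕ → Fin L → ℝ} (h : History L K)
    (a : Fin L) {p : ℝ} (hp : 0 ≤ p) (hp1 : p ≤ 1)
    (hα : ∀ s, 1 ≤ s → s ≤ h.length → 0 ≤ α s a ∧ α s a ≤ 1) :
    |discMean γ α h a - p * discN γ h a| ≤ discN γ h a := by
  induction h with
  | nil => simp [discMean, discN]
  | cons x h ih =>
    obtain ⟨R, c⟩ := x
    rw [discN_cons, discMean]
    have h1 := ih fun s hs hs' => hα s hs (by simp; omega)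
    obtain ⟨h2, h3⟩ := hα (h.length + 1) (by omega) (by simp)
    have h4 : |α (h.length + 1) a - p| ≤ 1 := by rw [abs_le]; constructor <;> linarith
    have h5 := examInd_nonneg R c a
    calc _ = |γ * (discMean γ α h a - p * discN γ h a) +
          (α (h.length + 1) a - p) * examInd R c a| := by congr 1; ring
      _ ≤ γ * |discMean γ α h a - p * discN γ h a| + |α (h.length + 1) a - p| *
          examInd R c a := by
        refine (abs_add_le _ _).trans ?_
        rw [abs_mul, abs_mul, abs_of_nonneg hγ, abs_of_nonneg h5]
      _ ≤ γ * discN γ h a + 1 * examInd R c a := by gcongr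
      _ = _ := by ring

/-- If the mean has been `p` during the last `W` steps, then the bias caused by older observations
is at most `γ ^ W / (1 - γ)`. -/
theorem abs_discMean_sub_le_pow {γ : ℝ} (hγ : 0 ≤ γ) (hγ1 : γ < 1) {α : ℕ → Fin L → ℝ} (W : ℕ)
    (h : History L K) (a : Fin L) {p : ℝ} (hp : 0 ≤ p) (hp1 : p ≤ 1)
    (hα : ∀ s, 1 ≤ s → s ≤ h.length → 0 ≤ α s a ∧ α s a ≤ 1)
    (hc : ∀ s, 1 ≤ s → s ≤ h.length → h.length < s + W → α s a = p) :
    |discMean γ α h a - p * discN γ h a| ≤ γ ^ W / (1 - γ) := by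
  have hγ' : 0 < 1 - γ := by linarith
  induction W generalizing h with
  | zero =>
    refine (abs_discMean_sub_le hγ h a hp hp1 hα).trans ?_
    simpa using (discN_le_horizon hγ hγ1 h a).trans (horizon_le hγ hγ1 _)
  | succ W ih =>
    cases h with
    | nil =>
      simp only [discMean, discN, mul_zero, sub_zero, abs_zero]
      positivity
    | cons x h =>
      obtain ⟨R, c⟩ := x
      rw [discN_cons, discMean]
      have h1 := ih h (fun s hs hs' => hα s hs (by simp; omega))
        (fun s hs hs' hs'' => hc s hs (by simp; omega) (by simp; omega))
      rw [hc (h.length + 1) (by omega) (by simp) (by simp)]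
      calc _ = |γ * (discMean γ α h a - p * discN γ h a)| := by congr 1; ring
        _ = γ * |discMean γ α h a - p * discN γ h a| := by rw [abs_mul, abs_of_nonneg hγ]
        _ ≤ γ * (γ ^ W / (1 - γ)) := by gcongr
        _ = _ := by rw [pow_succ]; ring

variable {Ω : Type u} [MeasurableSpace Ω] {μ : Measure Ω} {n : ℕ}
  {α : ℕ → Fin L → ℝ} {A : ℕ → Ω → Fin L → Bool}

theorem IsEnvironment.integrable_hist [IsProbabilityMeasure μ] (hA : IsEnvironment μ n α A)
    (π : History L K → RankedList L K) {t : ℕ} (ht : t ≤ n) (G : History L K → ℝ) :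
    Integrable (fun ω => G (hist π (fun s => A s ω) t)) μ :=
  hA.integrable (F := fun B => G (hist π B t)) fun B B' h => by
    rw [hist_congr π fun s hs => h s (by simp only [Finset.mem_Icc] at hs ⊢; omega)]

/-- Discounting multiplies the old centred sum by `γ`, which replaces the tilt `r` by `rγ`. The
compensator becomes `γ r²N/8`, which dominates the required `γ² r²N/8` since `γ ≤ 1`. The induction
thus runs over all tilts at once. -/
theorem IsEnvironment.integral_exp_le_one [IsProbabilityMeasure μ] (hA : IsEnvironment μ n α A)
    (π : History L K → RankedList L K) {γ : ℝ} (hγ : 0 ≤ γ) (hγ1 : γ ≤ 1) (a : Fin L) {t : ℕ}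
    (ht : t ≤ n) (r : ℝ) :
    ∫ ω, Real.exp (r * (discX γ (hist π (fun s => A s ω) t) a -
      discMean γ α (hist π (fun s => A s ω) t) a) -
        r ^ 2 / 8 * discN γ (hist π (fun s => A s ω) t) a) ∂μ ≤ 1 := by
  induction t generalizing r with
  | zero => simp [hist, discX, discMean, discN]
  | succ t ih =>
    let Y : ℝ → History L K → ℝ := fun r h =>
      Real.exp (r * (discX γ h a - discMean γ α h a) - r ^ 2 / 8 * discN γ h a)
    let G : History L K → (Fin L → Bool) → ℝ := fun h v => Y r ((π h, click (π h) v) :: h)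
    calc _ = ∫ ω, G (hist π (fun s => A s ω) t) (A (t + 1) ω) ∂μ := rfl
      _ = ∫ ω, ∑ v, bernWeight (α (t + 1)) v * G (hist π (fun s => A s ω) t) v ∂μ :=
        hA.integral_step π ht G
      _ ≤ ∫ ω, Y (r * γ) (hist π (fun s => A s ω) t) ∂μ := by
        refine integral_mono
          (hA.integrable_hist π (by omega) fun h => ∑ v, bernWeight (α (t + 1)) v * G h v)
          (hA.integrable_hist π (by omega) (Y (r * γ))) fun ω => ?_
        have hp := fun b => hA.mem_unitInterval (t := t + 1) (by simp [ht]) b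
        have hlen := length_hist π (fun s => A s ω) t
        simp only
        generalize hist π (fun s => A s ω) t = h at hlen
        have hG : ∀ v, G h v ≤ Y (r * γ) h * Real.exp (r * (clickInd (π h) (click (π h) v) a -
            α (t + 1) a * examInd (π h) (click (π h) v) a) -
            r ^ 2 / 8 * examInd (π h) (click (π h) v) a) := by
          intro v
          simp only [G, Y, discN_cons, discX_cons, discMean, hlen]
          rw [← Real.exp_add, Real.exp_le_exp]
          have h1 : 0 ≤ r ^ 2 / 8 * discN γ h a * (γ * (1 - γ)) := by
            have := discN_nonneg hγ h a
            have : 0 ≤ 1 - γ := by linarith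
            positivity
          nlinarith
        calc ∑ v, bernWeight (α (t + 1)) v * G h v ≤ ∑ v, bernWeight (α (t + 1)) v *
              (Y (r * γ) h * Real.exp (r * (clickInd (π h) (click (π h) v) a -
            α (t + 1) a * examInd (π h) (click (π h) v) a) -
            r ^ 2 / 8 * examInd (π h) (click (π h) v) a)) :=
              Finset.sum_le_sum fun v _ =>
                mul_le_mul_of_nonneg_left (hG v) (bernWeight_nonneg hp v)
          _ = Y (r * γ) h * ∑ v, bernWeight (α (t + 1)) v *
              Real.exp (r * (clickInd (π h) (click (π h) v) a -
            α (t + 1) a * examInd (π h) (click (π h) v) a) -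
            r ^ 2 / 8 * examInd (π h) (click (π h) v) a) := by
              rw [Finset.mul_sum]
              exact Finset.sum_congr rfl fun v _ => by ring
          _ ≤ Y (r * γ) h := mul_le_of_le_one_right (Real.exp_pos _).le
              (sum_bernWeight_exp_le_one hp (π h) a r)
      _ ≤ 1 := ih (by omega) (r * γ)

/-- The exponential tilt used for discounted counts in `[3/4 * 4 ^ k, 3/4 * 4 ^ (k + 1)]`. -/
noncomputable def tilt (l : ℝ) (k : ℕ) : ℝ := 14 / 5 * (√l / √(3 / 4 * 4 ^ k))

/-- The optimal tilt depends on the random `N`, so geometric scales of ratio `4` are used. A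
deviation forces `N ≥ 3/4`, hence the scales start there, and `N ≤ exp l` leaves at most `⌈l⌉ + 1`
of them. -/
theorem exists_tilt_exponent_ge {l N S : ℝ} (hl : 2 / 3 ≤ l) (hN : 0 < N) (hNl : N ≤ Real.exp l)
    (hS : |S| ≤ N) (hdev : 9 / 8 * l * N ≤ S ^ 2) :
    ∃ k < ⌈l⌉₊ + 1, 49 / 25 * l ≤ tilt l k * |S| - tilt l k ^ 2 / 8 * N := by
  have hN1 : 3 / 4 ≤ N := by
    have h1 : S ^ 2 ≤ N ^ 2 := by rw [← sq_abs S]; gcongr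
    have h2 : 9 / 8 * l * N ≤ N * N := by linarith
    have h3 := le_of_mul_le_mul_right h2 hN
    linarith
  obtain ⟨k, hk, hk'⟩ := exists_nat_pow_near (x := N / (3 / 4)) (y := (4 : ℝ))
    (by rw [le_div_iff₀] <;> linarith) (by norm_num)
  refine ⟨k, ?_, ?_⟩
  · by_contra hlt
    push Not at hlt
    have h1 : (4 : ℝ) ^ (⌈l⌉₊ + 1) ≤ 4 ^ k := pow_le_pow_right₀ (by norm_num) hlt
    have h2 : Real.exp l ≤ 4 ^ ⌈l⌉₊ := by
      calc Real.exp l ≤ Real.exp ⌈l⌉₊ := Real.exp_le_exp.2 (Nat.le_ceil l)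
        _ = Real.exp 1 ^ ⌈l⌉₊ := by rw [← Real.exp_nat_mul, mul_one]
        _ ≤ _ := by
          gcongr
          linarith [Real.exp_one_lt_d9]
    rw [pow_succ] at h1
    have h3 : N / (3 / 4) = 4 / 3 * N := by ring
    have := Real.exp_pos l
    linarith
  · set z : ℝ := 3 / 4 * 4 ^ k with hz
    have hz0 : 0 < z := by positivity
    have hzN : z ≤ N := by
      rw [le_div_iff₀ (by norm_num)] at hk
      linarith
    have hNz : N ≤ 4 * z := by
      rw [div_lt_iff₀ (by norm_num), pow_succ] at hk'
      linarith
    have hq := Real.sq_sqrt (show 0 ≤ l by linarith)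
    have hrz := Real.sq_sqrt hz0.le
    have hw := Real.sq_sqrt hN.le
    have h1 : 1 ≤ √N / √z := by
      rw [le_div_iff₀ (Real.sqrt_pos.2 hz0), one_mul]
      exact Real.sqrt_le_sqrt hzN
    have h2 : √N / √z ≤ 2 := by
      rw [div_le_iff₀ (Real.sqrt_pos.2 hz0)]
      refine (Real.sqrt_le_sqrt hNz).trans (le_of_eq ?_)
      rw [Real.sqrt_mul (by norm_num), show (4 : ℝ) = 2 ^ 2 by norm_num, Real.sqrt_sq (by norm_num)]
    -- `(53/50)² < 9/8`.
    have hS2 : 53 / 50 * (√l * √N) ≤ |S| := by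
      refine abs_le_of_sq_le_sq' ?_ (abs_nonneg S) |>.2
      rw [sq_abs, mul_pow, mul_pow, hq, hw]
      refine le_trans ?_ hdev
      have : 0 ≤ l * N := mul_nonneg (by linarith) hN.le
      nlinarith
    set s := √N / √z with hs
    have h3 : 742 / 250 * l * s ≤ tilt l k * |S| := by
      have : 0 ≤ tilt l k := by unfold tilt; positivity
      refine le_trans (le_of_eq ?_) (mul_le_mul_of_nonneg_left hS2 this)
      rw [tilt, ← hz, hs]
      linear_combination (-(742 / 250) * (√N / √z)) * hq
    have h4 : tilt l k ^ 2 / 8 * N = 49 / 50 * l * s ^ 2 := by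
      rw [tilt, hs, ← hz, mul_pow, div_pow, div_pow, div_pow, hq, hw]
      ring
    rw [h4]
    -- The lower bound `l (2.968 s - 0.98 s²)` is concave in `s ∈ [1,2]` and at least `1.96 l` at
    -- both ends; the factor `14/5` in `tilt` balances the two ends.
    have h5 : 0 ≤ l * ((s - 1) * (2 - s)) :=
      mul_nonneg (by linarith) (mul_nonneg (by linarith) (by linarith))
    have h6 : 0 ≤ l * s := mul_nonneg (by linarith) (by linarith)
    nlinarith

/-- Deviation bound for the discounted click rate, uniform over the random discounted count. -/
theorem IsEnvironment.integral_deviation_le [IsProbabilityMeasure μ] (hA : IsEnvironment μ n α A)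
    (π : History L K → RankedList L K) {γ : ℝ} (hγ : 0 ≤ γ) (hγ1 : γ < 1) (a : Fin L) {t : ℕ}
    (ht : t ≤ n) {l : ℝ} (hl : 2 / 3 ≤ l) (htl : horizon γ t ≤ Real.exp l)
    (P : History L K → Prop) [DecidablePred P]
    (hP : ∀ h : History L K, P h → 0 < discN γ h a ∧
      9 / 8 * l * discN γ h a ≤ (discX γ h a - discMean γ α h a) ^ 2) :
    ∫ ω, (if P (hist π (fun s => A s ω) t) then 1 else 0) ∂μ ≤ 4 * Real.exp (-l) := by
  let Y : ℝ → History L K → ℝ := fun r h =>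
    Real.exp (r * (discX γ h a - discMean γ α h a) - r ^ 2 / 8 * discN γ h a)
  let Z : History L K → ℝ := fun h =>
    ∑ k ∈ Finset.range (⌈l⌉₊ + 1), (Y (tilt l k) h + Y (-tilt l k) h)
  have hY : ∀ r h, 0 ≤ Y r h := fun r h => (Real.exp_pos _).le
  have h1 : ∀ ω, (if P (hist π (fun s => A s ω) t) then (1 : ℝ) else 0) ≤
      Real.exp (-(49 / 25 * l)) * Z (hist π (fun s => A s ω) t) := by
    intro ω
    have hlen := length_hist π (fun s => A s ω) t
    generalize hist π (fun s => A s ω) t = h at hlen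
    split_ifs with hh
    · obtain ⟨h2, h3⟩ := hP h hh
      obtain ⟨k, hk, hk'⟩ := exists_tilt_exponent_ge hl h2
        ((discN_le_horizon hγ hγ1 h a).trans (hlen ▸ htl))
        (abs_discX_sub_discMean_le hγ h a fun s hs hs' =>
          hA.mem_unitInterval (by simp only [Finset.mem_Icc]; omega) a) h3
      have h4 : Real.exp (49 / 25 * l) ≤ Y (tilt l k) h + Y (-tilt l k) h := by
        rcases abs_cases (discX γ h a - discMean γ α h a) with ⟨h5, -⟩ | ⟨h5, -⟩
        · have : Real.exp (49 / 25 * l) ≤ Y (tilt l k) h := by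
            rw [h5] at hk'; exact Real.exp_le_exp.2 hk'
          linarith [hY (-tilt l k) h]
        · have : Real.exp (49 / 25 * l) ≤ Y (-tilt l k) h := by
            rw [h5] at hk'
            refine Real.exp_le_exp.2 (hk'.trans (le_of_eq ?_))
            ring
          linarith [hY (tilt l k) h]
      have h6 : Y (tilt l k) h + Y (-tilt l k) h ≤ Z h :=
        Finset.single_le_sum (f := fun k => Y (tilt l k) h + Y (-tilt l k) h)
          (fun j _ => add_nonneg (hY _ _) (hY _ _)) (Finset.mem_range.2 hk)
      rw [Real.exp_neg, ← div_eq_inv_mul, le_div_iff₀ (Real.exp_pos _)]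
      linarith
    · exact mul_nonneg (Real.exp_pos _).le
        (Finset.sum_nonneg fun j _ => add_nonneg (hY _ _) (hY _ _))
  have hZ : ∫ ω, Z (hist π (fun s => A s ω) t) ∂μ ≤ 2 * (l + 2) := by
    simp only [Z]
    rw [integral_finsetSum _ fun k _ => hA.integrable_hist π ht fun h => Y (tilt l k) h +
      Y (-tilt l k) h]
    have h2 : ∀ k ∈ Finset.range (⌈l⌉₊ + 1), ∫ ω, (Y (tilt l k) (hist π (fun s => A s ω) t) +
        Y (-tilt l k) (hist π (fun s => A s ω) t)) ∂μ ≤ 2 := by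
      intro k _
      rw [integral_add (hA.integrable_hist π ht (Y (tilt l k)))
        (hA.integrable_hist π ht (Y (-tilt l k)))]
      linarith [hA.integral_exp_le_one π hγ hγ1.le a ht (tilt l k),
        hA.integral_exp_le_one π hγ hγ1.le a ht (-tilt l k)]
    refine (Finset.sum_le_card_nsmul _ _ _ h2).trans ?_
    have := Nat.ceil_lt_add_one (show 0 ≤ l by linarith)
    simp
    linarith
  calc _ ≤ ∫ ω, Real.exp (-(49 / 25 * l)) * Z (hist π (fun s => A s ω) t) ∂μ :=
        integral_mono (hA.integrable_hist π ht fun h => if P h then (1 : ℝ) else 0)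
          (hA.integrable_hist π ht fun h => Real.exp (-(49 / 25 * l)) * Z h) h1
    _ = Real.exp (-(49 / 25 * l)) * ∫ ω, Z (hist π (fun s => A s ω) t) ∂μ :=
        integral_const_mul _ _
    -- The union over scales and signs costs `2(l + 2) ≤ 4 exp(24l/25)`: the excess of the exponent
    -- `49l/25` over `l` absorbs it.
    _ ≤ Real.exp (-(49 / 25 * l)) * (2 * (2 * Real.exp (24 / 25 * l))) := by
        gcongr
        have := Real.add_one_le_exp (24 / 25 * l)
        linarith
    _ = 4 * (Real.exp (-(49 / 25 * l)) * Real.exp (24 / 25 * l)) := by ring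
    _ = _ := by
        rw [← Real.exp_add]
        congr 2
        ring

end

/-! ### Total cost of the examinations of one item. -/

section

/-- The function `min 1 √(Y / x)`, equal to `1` at `x = 0`. -/
noncomputable def gapCap (Y x : ℝ) : ℝ := if x ≤ Y then 1 else √(Y / x)

/-- `gapCap`, cut off below `Δ`. -/
noncomputable def cutCap (Y Δ x : ℝ) : ℝ := if Δ ≤ gapCap Y x then gapCap Y x else 0

theorem gapCap_nonneg (Y x : ℝ) : 0 ≤ gapCap Y x := by
  unfold gapCap; split_ifs <;> positivity

theorem gapCap_le_one {Y : ℝ} (hY : 0 ≤ Y) (x : ℝ) : gapCap Y x ≤ 1 := by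
  unfold gapCap
  split_ifs with h
  · exact le_rfl
  · rw [Real.sqrt_le_one, div_le_one] <;> linarith

theorem cutCap_nonneg (Y Δ x : ℝ) : 0 ≤ cutCap Y Δ x := by
  unfold cutCap; split_ifs
  · exact gapCap_nonneg _ _
  · exact le_rfl

theorem cutCap_le_gapCap (Y Δ x : ℝ) : cutCap Y Δ x ≤ gapCap Y x := by
  unfold cutCap; split_ifs
  · exact le_rfl
  · exact gapCap_nonneg _ _

theorem gapCap_antitone {Y : ℝ} (hY : 0 < Y) : Antitone (gapCap Y) := by
  intro x y hxy
  by_cases hx : x ≤ Y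
  · simpa [gapCap, hx] using gapCap_le_one hY.le y
  · have hy : ¬ y ≤ Y := by linarith
    have : 0 < x := by linarith
    simp only [gapCap, hx, hy, if_false]
    gcongr

theorem cutCap_antitone {Y : ℝ} (hY : 0 < Y) (Δ : ℝ) : Antitone (cutCap Y Δ) := by
  intro x y hxy
  have h := gapCap_antitone hY hxy
  unfold cutCap
  split_ifs with h1 h2 h2
  · exact h
  · exact absurd (h1.trans h) h2
  · exact gapCap_nonneg _ _
  · exact le_rfl

theorem le_gapCap {Y x g : ℝ} (hY : 0 < Y) (hg1 : g ≤ 1) (h : g ^ 2 * x ≤ Y) : g ≤ gapCap Y x := by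
  unfold gapCap
  split_ifs with hx
  · exact hg1
  · have : 0 < x := by linarith
    refine Real.le_sqrt_of_sq_le ?_
    rwa [le_div_iff₀ this]

theorem le_cutCap {Y x g Δ : ℝ} (hY : 0 < Y) (hΔ : Δ ≤ g) (hg1 : g ≤ 1) (h : g ^ 2 * x ≤ Y) :
    g ≤ cutCap Y Δ x := by
  have h1 := le_gapCap hY hg1 h
  rwa [cutCap, if_pos (hΔ.trans h1)]

theorem cutCap_mul {Y c : ℝ} (hc : 0 < c) (Δ x : ℝ) : cutCap Y Δ (c * x) = cutCap (Y / c) Δ x := by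
  have h : gapCap Y (c * x) = gapCap (Y / c) x := by
    unfold gapCap
    simp only [le_div_iff₀ hc, mul_comm x c, div_div]
  simp only [cutCap, h]

/-- The first `⌊Y⌋ + 1` terms are `1`; the others telescope through `1/√(J+1) ≤ 2(√(J+1) - √J)`. -/
theorem sum_gapCap_le {Y : ℝ} (hY : 0 < Y) {J : ℕ} (hJ : ⌊Y⌋₊ ≤ J) :
    ∑ j ∈ Finset.range (J + 1), gapCap Y j ≤
      ⌊Y⌋₊ + 1 + 2 * √Y * (√J - √(⌊Y⌋₊ : ℝ)) := by
  induction J, hJ using Nat.le_induction with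
  | base =>
    refine (Finset.sum_le_card_nsmul _ (fun j : ℕ => gapCap Y j) 1 fun j _ => gapCap_le_one hY.le j).trans ?_
    simp
  | succ J hJ ih =>
    rw [Finset.sum_range_succ]
    have h1 : ¬ ((J + 1 : ℕ) : ℝ) ≤ Y := by
      have := Nat.lt_floor_add_one Y
      have : (⌊Y⌋₊ : ℝ) ≤ J := by exact_mod_cast hJ
      push_cast
      linarith
    rw [gapCap, if_neg h1, Real.sqrt_div hY.le]
    have h2 : √Y / √((J + 1 : ℕ) : ℝ) ≤ 2 * √Y * (√((J + 1 : ℕ) : ℝ) - √J) := by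
      have h3 : 0 < √((J + 1 : ℕ) : ℝ) := Real.sqrt_pos.2 (by positivity)
      rw [div_le_iff₀ h3]
      have h4 : √((J + 1 : ℕ) : ℝ) ^ 2 = J + 1 := by rw [Real.sq_sqrt (by positivity)]; push_cast; rfl
      have h5 : √(J : ℝ) ^ 2 = J := Real.sq_sqrt (by positivity)
      have h6 : 1 ≤ 2 * (√((J + 1 : ℕ) : ℝ) - √J) * √((J + 1 : ℕ) : ℝ) := by
        nlinarith [sq_nonneg (√((J + 1 : ℕ) : ℝ) - √J)]
      have := mul_le_mul_of_nonneg_left h6 (Real.sqrt_nonneg Y)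
      linarith
    linarith

/-- Only `j ≤ Y/Δ²` contribute. The saving `-Y` must be kept: later it pays for the failures of the
confidence radii. -/
theorem sum_cutCap_le {Y Δ : ℝ} (hY : 0 < Y) (hΔ : 0 < Δ) (hΔ1 : Δ ≤ 1) (J : ℕ) :
    ∑ j ∈ Finset.range J, cutCap Y Δ j ≤ 2 * Y / Δ - Y + 2 := by
  set Q := ⌊Y / Δ ^ 2⌋₊ with hQ
  have hYΔ : Y ≤ Y / Δ ^ 2 := by
    rw [le_div_iff₀ (by positivity)]
    have : Δ ^ 2 ≤ 1 := pow_le_one₀ hΔ.le hΔ1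
    nlinarith
  have h1 : ∑ j ∈ Finset.range J, cutCap Y Δ j ≤ ∑ j ∈ Finset.range (Q + 1), gapCap Y j := by
    calc _ = ∑ j ∈ (Finset.range J).filter (fun j : ℕ => cutCap Y Δ j ≠ 0), cutCap Y Δ j :=
          (Finset.sum_filter_ne_zero _).symm
      _ ≤ ∑ j ∈ Finset.range (Q + 1), cutCap Y Δ j := by
          refine Finset.sum_le_sum_of_subset_of_nonneg ?_ fun j _ _ => cutCap_nonneg _ _ _
          intro j hj
          simp only [Finset.mem_filter] at hj
          have h2 : Δ ≤ gapCap Y j := by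
            by_contra hn
            exact hj.2 (by simp [cutCap, hn])
          rw [Finset.mem_range, Nat.lt_succ_iff]
          refine Nat.le_floor ?_
          unfold gapCap at h2
          split_ifs at h2 with h3
          · exact h3.trans hYΔ
          · have hj0 : (0 : ℝ) < j := by linarith
            have h4 := (Real.le_sqrt hΔ.le (by positivity)).1 h2
            rw [le_div_iff₀ hj0] at h4
            rw [le_div_iff₀ (by positivity)]
            linarith
      _ ≤ _ := Finset.sum_le_sum fun j _ => cutCap_le_gapCap _ _ _
  have h2 := sum_gapCap_le hY (J := Q) (Nat.floor_le_floor hYΔ)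
  have h3 : √Y * √Q ≤ Y / Δ := by
    rw [← Real.sqrt_mul hY.le]
    refine Real.sqrt_le_iff.2 ⟨by positivity, ?_⟩
    have := Nat.floor_le (show 0 ≤ Y / Δ ^ 2 by positivity)
    calc Y * Q ≤ Y * (Y / Δ ^ 2) := by gcongr
      _ = _ := by ring
  have h4 : (⌊Y⌋₊ : ℝ) ≤ √Y * √(⌊Y⌋₊ : ℝ) := by
    have h5 : √(⌊Y⌋₊ : ℝ) ≤ √Y := Real.sqrt_le_sqrt (Nat.floor_le hY.le)
    have h6 : √(⌊Y⌋₊ : ℝ) * √(⌊Y⌋₊ : ℝ) = ⌊Y⌋₊ := Real.mul_self_sqrt (by positivity)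
    nlinarith [Real.sqrt_nonneg (⌊Y⌋₊ : ℝ)]
  have h5 := Nat.lt_floor_add_one Y
  have h6 : 2 * Y / Δ = 2 * (Y / Δ) := by ring
  rw [h6]
  nlinarith

/-- The elements of `S` have distinct ranks `0, 1, …`; by monotonicity `N t` may be replaced by `c`
times the rank, and rescaling turns `Y` into `Y / c`. -/
theorem sum_cutCap_window_le {Y c Δ : ℝ} (hY : 0 < Y) (hc : 0 < c) (hΔ : 0 < Δ) (hΔ1 : Δ ≤ 1)
    (S : Finset ℕ) (N : ℕ → ℝ)
    (hN : ∀ t ∈ S, c * (S.filter (· < t)).card ≤ N t) :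
    ∑ t ∈ S, cutCap Y Δ (N t) ≤ 2 * (Y / c) / Δ - Y / c + 2 := by
  let j : ℕ → ℕ := fun t => (S.filter (· < t)).card
  have hj : Set.InjOn j S := by
    have hlt : ∀ s ∈ S, ∀ t ∈ S, s < t → j s < j t := by
      intro s hs t ht hst
      refine Finset.card_lt_card ?_
      rw [Finset.ssubset_iff_of_subset]
      · exact ⟨s, by simp [hs, hst], by simp⟩
      · intro r hr
        simp only [Finset.mem_filter] at hr ⊢
        exact ⟨hr.1, hr.2.trans hst⟩
    intro s hs t ht hst
    rcases lt_trichotomy s t with h | h | h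
    · exact absurd hst (hlt s hs t ht h).ne
    · exact h
    · exact absurd hst (hlt t ht s hs h).ne'
  calc ∑ t ∈ S, cutCap Y Δ (N t) ≤ ∑ t ∈ S, cutCap (Y / c) Δ (j t) := by
        refine Finset.sum_le_sum fun t ht => ?_
        rw [← cutCap_mul hc]
        exact cutCap_antitone hY Δ (hN t ht)
    _ = ∑ i ∈ S.image j, cutCap (Y / c) Δ i := (Finset.sum_image (f := fun i : ℕ =>
          cutCap (Y / c) Δ i) hj).symm
    _ ≤ ∑ i ∈ Finset.range (S.card + 1), cutCap (Y / c) Δ i := by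
        refine Finset.sum_le_sum_of_subset_of_nonneg ?_ fun j _ _ => cutCap_nonneg _ _ _
        intro i hi
        obtain ⟨t, -, rfl⟩ := Finset.mem_image.1 hi
        rw [Finset.mem_range, Nat.lt_succ_iff]
        exact Finset.card_filter_le _ _
    _ ≤ _ := sum_cutCap_le (by positivity) hΔ hΔ1 _

variable {L K : ℕ}

/-- Indicator that item `a` is examined at step `t`. -/
noncomputable def examAt (π : History L K → RankedList L K) (A : ℕ → Fin L → Bool) (t : ℕ)
    (a : Fin L) : ℝ :=
  examInd (shown π A t) (click (shown π A t) (A t)) a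

theorem discN_hist (π : History L K → RankedList L K) (A : ℕ → Fin L → Bool) (γ : ℝ) (t : ℕ)
    (a : Fin L) :
    discN γ (hist π A t) a = ∑ s ∈ Finset.Icc 1 t, γ ^ (t - s) * examAt π A s a := by
  induction t with
  | zero => simp [hist, discN]
  | succ t ih =>
    rw [hist, discN_cons, ih, Finset.sum_Icc_succ_top (by omega), Finset.mul_sum]
    congr 1
    · refine Finset.sum_congr rfl fun s hs => ?_
      rw [Finset.mem_Icc] at hs
      rw [show t + 1 - s = t - s + 1 by omega, pow_succ]
      ring
    · simp [examAt, shown]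

/-- Time is cut into the blocks on which `⌈t(1-γ)⌉` is constant. Two steps of a block are less than
`1/(1-γ)` apart, so an earlier examination in the block still has weight at least `γ^(1/(1-γ))`. -/
theorem sum_examAt_cutCap_le (π : History L K → RankedList L K) (A : ℕ → Fin L → Bool) {γ : ℝ}
    (hγ : 0 < γ) (hγ1 : γ < 1) (n : ℕ) (a : Fin L) {Y Δ : ℝ} (hY : 0 < Y) (hΔ : 0 < Δ)
    (hΔ1 : Δ ≤ 1) :
    ∑ t ∈ Finset.Icc 1 n, examAt π A t a * cutCap Y Δ (discN γ (hist π A (t - 1)) a) ≤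
      ⌈(n : ℝ) * (1 - γ)⌉₊ * (2 * (Y / γ ^ (1 / (1 - γ))) / Δ - Y / γ ^ (1 / (1 - γ)) + 2) := by
  classical
  have hx : 0 < 1 - γ := by linarith
  have h1 : ∑ t ∈ Finset.Icc 1 n, examAt π A t a * cutCap Y Δ (discN γ (hist π A (t - 1)) a) =
      ∑ t ∈ (Finset.Icc 1 n).filter (fun t => examAt π A t a = 1),
        cutCap Y Δ (discN γ (hist π A (t - 1)) a) := by
    rw [Finset.sum_filter]
    refine Finset.sum_congr rfl fun t _ => ?_
    rcases examInd_eq_zero_or_one (shown π A t) (click (shown π A t) (A t)) a with h | h <;>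
      simp [examAt, h]
  rw [h1, ← Finset.sum_fiberwise_of_maps_to (t := Finset.Icc 1 ⌈(n : ℝ) * (1 - γ)⌉₊)
    (g := fun t : ℕ => ⌈(t : ℝ) * (1 - γ)⌉₊)]
  · refine (Finset.sum_le_card_nsmul _ _
      (2 * (Y / γ ^ (1 / (1 - γ))) / Δ - Y / γ ^ (1 / (1 - γ)) + 2) ?_).trans
      (by rw [Nat.card_Icc, Nat.add_sub_cancel, nsmul_eq_mul])
    intro k hk
    refine sum_cutCap_window_le hY (by positivity) hΔ hΔ1 _
      (fun t => discN γ (hist π A (t - 1)) a) ?_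
    intro t ht
    set S := ((Finset.Icc 1 n).filter (fun t => examAt π A t a = 1)).filter
      fun t : ℕ => ⌈(t : ℝ) * (1 - γ)⌉₊ = k
    have hS : ∀ s ∈ S, 1 ≤ s ∧ examAt π A s a = 1 ∧ ⌈(s : ℝ) * (1 - γ)⌉₊ = k := by
      intro s hs
      simp only [S, Finset.mem_filter, Finset.mem_Icc] at hs
      tauto
    rw [discN_hist]
    calc γ ^ (1 / (1 - γ)) * (S.filter (· < t)).card
        = ∑ s ∈ S.filter (· < t), γ ^ (1 / (1 - γ)) := by simp [mul_comm]
      _ ≤ ∑ s ∈ S.filter (· < t), γ ^ (t - 1 - s) * examAt π A s a := by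
        refine Finset.sum_le_sum fun s hs => ?_
        rw [Finset.mem_filter] at hs
        obtain ⟨hs1, hs2, hs3⟩ := hS s hs.1
        obtain ⟨ht1, ht2, ht3⟩ := hS t ht
        rw [hs2, mul_one, ← Real.rpow_natCast]
        refine Real.rpow_le_rpow_of_exponent_ge hγ hγ1.le ?_
        rw [le_div_iff₀ hx]
        have h2 := Nat.ceil_lt_add_one (show 0 ≤ (s : ℝ) * (1 - γ) by positivity)
        have h3 := Nat.le_ceil ((t : ℝ) * (1 - γ))
        rw [hs3] at h2
        rw [ht3] at h3
        have h4 : ((t - 1 - s : ℕ) : ℝ) ≤ t - s := by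
          rw [Nat.cast_sub (by omega), Nat.cast_sub (by omega)]
          push_cast
          linarith
        nlinarith
      _ ≤ _ := by
        refine Finset.sum_le_sum_of_subset_of_nonneg ?_ fun s _ _ =>
          mul_nonneg (pow_nonneg hγ.le _) (examInd_nonneg _ _ _)
        intro s hs
        rw [Finset.mem_filter] at hs
        have := hS s hs.1
        rw [Finset.mem_Icc]
        omega
  · intro t ht
    simp only [Finset.mem_filter, Finset.mem_Icc] at ht
    rw [Finset.mem_Icc]
    constructor
    · rw [Nat.one_le_ceil_iff]
      have : (0 : ℝ) < t := by exact_mod_cast ht.1.1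
      positivity
    · refine Nat.ceil_mono ?_
      have : (t : ℝ) ≤ n := by exact_mod_cast ht.1.2
      gcongr

end

/-! ### Deterministic decomposition of the loss of a list. -/

section

variable {L K : ℕ}

/-- The items of a `K`-element set `D` can be matched with the positions of a list such that the
items of the list that belong to `D` are matched with their own positions. -/
theorem exists_matching (R : RankedList L K) {D : Finset (Fin L)} (hD : D.card = K) :
    ∃ d : Fin K → Fin L, Function.Injective d ∧ (∀ i, d i ∈ D) ∧ (∀ i, R i ∈ D → d i = R i) ∧
      ∀ i, R i ∉ D → ∀ j, R j ≠ d i := by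
  classical
  have hcard : (Finset.univ.filter fun i => R i ∉ D).card = (D \ Finset.univ.map R).card := by
    have h1 : (Finset.univ.filter fun i => R i ∉ D).card = (Finset.univ.map R \ D).card := by
      rw [← Finset.card_map R]
      congr 1
      ext a
      simp only [Finset.mem_map, Finset.mem_filter, Finset.mem_univ, true_and, Finset.mem_sdiff]
      constructor
      · rintro ⟨i, hi, rfl⟩
        exact ⟨⟨i, rfl⟩, hi⟩
      · rintro ⟨⟨i, rfl⟩, hi⟩
        exact ⟨i, hi, rfl⟩
    rw [h1]
    exact Finset.card_sdiff_comm (by simp [hD])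
  let e := Finset.equivOfCardEq hcard
  let d : Fin K → Fin L := fun i =>
    if h : R i ∈ D then R i else (e ⟨i, by simpa using h⟩ : Fin L)
  have hd1 : ∀ i, R i ∈ D → d i = R i := fun i h => dif_pos h
  have hd2 : ∀ i (h : R i ∉ D), d i = e ⟨i, by simpa using h⟩ := fun i h => dif_neg h
  have hd3 : ∀ i, R i ∉ D → d i ∈ D \ Finset.univ.map R := fun i h => by
    rw [hd2 i h]; exact (e _).2
  refine ⟨d, ?_, ?_, hd1, ?_⟩
  · intro i j hij
    by_cases hi : R i ∈ D <;> by_cases hj : R j ∈ D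
    · rw [hd1 i hi, hd1 j hj] at hij
      exact R.injective hij
    · have := hd3 j hj
      rw [← hij, hd1 i hi] at this
      simp at this
    · have := hd3 i hi
      rw [hij, hd1 j hj] at this
      simp at this
    · rw [hd2 i hi, hd2 j hj] at hij
      simpa using e.injective (Subtype.ext hij)
  · intro i
    by_cases hi : R i ∈ D
    · rwa [hd1 i hi]
    · exact (Finset.mem_sdiff.1 (hd3 i hi)).1
  · intro i hi j hj
    have := (Finset.mem_sdiff.1 (hd3 i hi)).2
    rw [← hj] at this
    simp at this

theorem prod_eq_prod_of_injective {d : Fin K → Fin L} (hd : Function.Injective d)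
    {D : Finset (Fin L)} (hD : D.card = K) (hdD : ∀ i, d i ∈ D) (f : Fin L → ℝ) :
    ∏ a ∈ D, f a = ∏ i, f (d i) := by
  have h : Finset.univ.map ⟨d, hd⟩ = D := by
    refine Finset.eq_of_subset_of_card_le ?_ (by simp [hD])
    intro a ha
    obtain ⟨i, -, rfl⟩ := Finset.mem_map.1 ha
    exact hdD i
  rw [← h, Finset.prod_map]
  rfl

theorem prod_le_prod_list {p : Fin L → ℝ} (hp : ∀ a, 0 ≤ p a ∧ p a ≤ 1) {D : Finset (Fin L)}
    (hD : IsTopK K p D) (R : RankedList L K) :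
    ∏ a ∈ D, (1 - p a) ≤ ∏ i, (1 - p (R i)) := by
  obtain ⟨d, hd1, hd2, hd3, -⟩ := exists_matching R hD.1
  rw [prod_eq_prod_of_injective hd1 hD.1 hd2]
  refine Finset.prod_le_prod (fun i _ => by linarith [(hp (d i)).2]) fun i _ => ?_
  by_cases h : R i ∈ D
  · rw [hd3 i h]
  · linarith [hD.2 (d i) (hd2 i) (R i) h]

theorem iSup_reward_le {p : Fin L → ℝ} (hp : ∀ a, 0 ≤ p a ∧ p a ≤ 1) {D : Finset (Fin L)}
    (hD : IsTopK K p D) (R : RankedList L K) :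
    (⨆ R : RankedList L K, reward R p) ≤ 1 - ∏ a ∈ D, (1 - p a) := by
  have : Nonempty (RankedList L K) := ⟨R⟩
  exact ciSup_le fun R => by
    unfold reward
    linarith [prod_le_prod_list hp hD R]

/-- An enumeration of `D` in the order of decreasing values. -/
theorem exists_antitone_enum (p : Fin L → ℝ) {D : Finset (Fin L)} (hD : D.card = K) :
    ∃ e : Fin K → Fin L, Function.Injective e ∧ (∀ k, e k ∈ D) ∧ (∀ b ∈ D, ∃ k, e k = b) ∧
      Antitone fun k => p (e k) := by
  let f := (D.equivFinOfCardEq hD).symm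
  let σ := Tuple.sort fun i => -p (f i)
  refine ⟨fun k => f (σ k), ?_, fun k => (f _).2, ?_, ?_⟩
  · exact Subtype.val_injective.comp (f.injective.comp σ.injective)
  · intro b hb
    exact ⟨σ.symm (f.symm ⟨b, hb⟩), by simp⟩
  · intro i j hij
    have := Tuple.monotone_sort (fun i => -p (f i)) hij
    simpa using this

/-- Dropping factors from `[0,1]` can only increase a product. -/
theorem prod_mul_prod_le_prod_of_injOn {c : Fin K → ℝ} (hc0 : ∀ i, 0 ≤ c i) (hc1 : ∀ i, c i ≤ 1)
    {s : Finset (Fin K)} {g : Fin K → Fin K} (hg : Set.InjOn g s) {f : Fin K → ℝ}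
    (hf : ∀ k ∈ s, f k = c (g k)) : ∏ i, c i ≤ ∏ k ∈ s, f k := by
  classical
  rw [Finset.prod_congr rfl hf, ← Finset.prod_image hg,
    ← Finset.prod_sdiff (Finset.subset_univ (s.image g))]
  exact mul_le_of_le_one_left (Finset.prod_nonneg fun i _ => hc0 i)
    (Finset.prod_le_one (fun i _ => hc0 i) fun i _ => hc1 i)

/-- The summands are the probabilities that the first success occurs at `k`. Hence failures of
optimal items cost `L - K` in total, not `K (L - K)`. -/
theorem sum_mul_prod_earlier_le_one {q : Fin K → ℝ} (hq : ∀ k, q k ≤ 1) :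
    ∑ k, q k * ∏ j with j < k, (1 - q j) ≤ 1 := by
  have h := Finset.prod_one_sub_ordered Finset.univ q
  have h2 : 0 ≤ ∏ i, (1 - q i) := Finset.prod_nonneg fun i _ => by linarith [hq i]
  linarith

theorem card_list_sdiff_le (hKL : K ≤ L) (R : RankedList L K) {D : Finset (Fin L)}
    (hD : D.card = K) : ((Finset.univ.filter fun i => R i ∉ D).card : ℝ) ≤ (L : ℝ) - K := by
  have h : (Finset.univ.filter fun i => R i ∉ D).card ≤ Dᶜ.card := by
    rw [← Finset.card_map R]
    refine Finset.card_le_card ?_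
    intro a ha
    obtain ⟨i, hi, rfl⟩ := Finset.mem_map.1 ha
    simpa using hi
  rw [Finset.card_compl, hD, Fintype.card_fin] at h
  rw [← Nat.cast_sub hKL]
  exact_mod_cast h

/-- Splits the loss of a list into the part caused by items whose upper confidence radius is large
(`ψ`), by overestimated suboptimal items (`o`), and by underestimated optimal items (`u`). -/
theorem prod_list_sub_prod_le (hKL : K ≤ L) {p : Fin L → ℝ} (hp : ∀ a, 0 ≤ p a ∧ p a ≤ 1)
    {D : Finset (Fin L)} (hD : IsTopK K p D) (R : RankedList L K) {e : Fin K → Fin L}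
    (he : Function.Injective e) (heD : ∀ k, e k ∈ D) (hDe : ∀ b ∈ D, ∃ k, e k = b)
    (hanti : Antitone fun k => p (e k)) {o u ψ : Fin L → ℝ} (ho : ∀ a, o a = 0 ∨ o a = 1)
    (hu : ∀ a, u a = 0 ∨ u a = 1) (hψ : ∀ a, 0 ≤ ψ a)
    (hgood : ∀ i, R i ∉ D → o (R i) = 0 → ∀ b ∈ D, (∀ j, R j ≠ b) → u b = 0 →
      ∀ b' ∈ D, p b' ≤ p b → p b' - p (R i) ≤ ψ (R i)) :
    ∏ i, (1 - p (R i)) - ∏ a ∈ D, (1 - p a) ≤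
      ∑ i, (if R i ∈ D then 0 else ψ (R i)) * ∏ j with j < i, (1 - p (R j)) +
        ∑ a ∈ Dᶜ, o a + ((L : ℝ) - K) * ∑ k, u (e k) * (p (e k) * ∏ j with j < k, (1 - p (e j))) := by
  classical
  have ho0 : ∀ a, 0 ≤ o a := fun a => by rcases ho a with h | h <;> simp [h]
  have hu0 : ∀ a, 0 ≤ u a := fun a => by rcases hu a with h | h <;> simp [h]
  have hLK : (0 : ℝ) ≤ (L : ℝ) - K := by
    have : (K : ℝ) ≤ L := by exact_mod_cast hKL
    linarith
  have hq0 : ∀ a, 0 ≤ 1 - p a := fun a => by linarith [(hp a).2]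
  have hq1 : ∀ a, 1 - p a ≤ 1 := fun a => by linarith [(hp a).1]
  have hprod0 : ∀ (f : Fin K → Fin L) (s : Finset (Fin K)), 0 ≤ ∏ j ∈ s, (1 - p (f j)) :=
    fun f s => Finset.prod_nonneg fun j _ => hq0 _
  have hprod1 : ∀ (f : Fin K → Fin L) (s : Finset (Fin K)), ∏ j ∈ s, (1 - p (f j)) ≤ 1 :=
    fun f s => Finset.prod_le_one (fun j _ => hq0 _) fun j _ => hq1 _
  have hS1 : 0 ≤ ∑ i, (if R i ∈ D then 0 else ψ (R i)) * ∏ j with j < i, (1 - p (R j)) :=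
    Finset.sum_nonneg fun i _ => mul_nonneg (by split_ifs; exacts [le_rfl, hψ _]) (hprod0 _ _)
  have hS2 : 0 ≤ ∑ a ∈ Dᶜ, o a := Finset.sum_nonneg fun a _ => ho0 a
  have hS3t : ∀ k, 0 ≤ u (e k) * (p (e k) * ∏ j with j < k, (1 - p (e j))) := fun k =>
    mul_nonneg (hu0 _) (mul_nonneg (hp _).1 (hprod0 _ _))
  have hS3 : 0 ≤ ((L : ℝ) - K) * ∑ k, u (e k) * (p (e k) * ∏ j with j < k, (1 - p (e j))) :=
    mul_nonneg hLK (Finset.sum_nonneg fun k _ => hS3t k)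
  obtain ⟨d, hd1, hd2, hd3, hd4⟩ := exists_matching R hD.1
  -- Telescoping that exchanges `R i` for its partner `d i` one position at a time; positions
  -- already holding an optimal item contribute `0`.
  have htel : ∏ i, (1 - p (R i)) - ∏ a ∈ D, (1 - p a) =
      ∑ i, (p (d i) - p (R i)) * (∏ j with j < i, (1 - p (R j))) *
        ∏ j with i < j, (1 - p (d j)) := by
    rw [prod_eq_prod_of_injective hd1 hD.1 hd2]
    have h := Finset.prod_sub_ordered Finset.univ (fun i => 1 - p (d i))
      (fun i => p (R i) - p (d i))
    simp only [sub_sub, add_sub_cancel] at h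
    rw [h, sub_sub_cancel_left, ← Finset.sum_neg_distrib]
    exact Finset.sum_congr rfl fun i _ => by ring
  have hterm0 : ∀ i, R i ∈ D → (p (d i) - p (R i)) * (∏ j with j < i, (1 - p (R j))) *
        ∏ j with i < j, (1 - p (d j)) = 0 := fun i hi => by rw [hd3 i hi]; ring
  rw [htel]
  by_cases hex : ∃ k, ∀ j, R j ≠ e k
  swap
  · push Not at hex
    rw [Finset.sum_eq_zero]
    · positivity
    · intro i _
      by_cases hi : R i ∈ D
      · exact hterm0 i hi
      · obtain ⟨k, hk⟩ := hDe (d i) (hd2 i)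
        obtain ⟨j, hj⟩ := hex k
        exact absurd (hj.trans hk) (hd4 i hi j)
  -- The best optimal item missing from the list: it is at least as attractive as every partner `d
  -- i` of a suboptimal `R i`, and all better-ranked optimal items are displayed.
  obtain ⟨k₀, hk₀, hmin⟩ := WellFounded.has_min (wellFounded_lt (α := Fin K))
    {k | ∀ j, R j ≠ e k} hex
  have hmin' : ∀ k < k₀, ∃ j, R j = e k := fun k hk => by
    by_contra hn
    push Not at hn
    exact hmin k hn hk
  have hle : ∀ i, R i ∉ D → p (d i) ≤ p (e k₀) := by
    intro i hi
    obtain ⟨k, hk⟩ := hDe (d i) (hd2 i)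
    rw [← hk]
    refine hanti (le_of_not_gt fun hlt => ?_)
    obtain ⟨j, hj⟩ := hmin' k hlt
    exact hd4 i hi j (hj.trans hk)
  -- If `e k₀` is not underestimated, each suboptimal `R i` is either overestimated or has its gap
  -- bounded by `ψ`. Otherwise the whole loss is charged to `e k₀`.
  rcases hu (e k₀) with hu' | hu'
  · have hbound : ∀ i, (p (d i) - p (R i)) * (∏ j with j < i, (1 - p (R j))) *
        ∏ j with i < j, (1 - p (d j)) ≤
        (if R i ∈ D then 0 else ψ (R i)) * ∏ j with j < i, (1 - p (R j)) +
          if R i ∈ D then 0 else o (R i) := by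
      intro i
      by_cases hi : R i ∈ D
      · simp [hi, hterm0 i hi]
      · simp only [if_neg hi]
        have h1 := hprod0 R (Finset.univ.filter (· < i))
        have h2 := hprod1 R (Finset.univ.filter (· < i))
        have h3 := hprod0 d (Finset.univ.filter (i < ·))
        have h4 := hprod1 d (Finset.univ.filter (i < ·))
        have h5 : 0 ≤ p (d i) - p (R i) := by linarith [hD.2 (d i) (hd2 i) (R i) hi]
        have h6 : (p (d i) - p (R i)) * (∏ j with j < i, (1 - p (R j))) *
            ∏ j with i < j, (1 - p (d j)) ≤
            (p (d i) - p (R i)) * (∏ j with j < i, (1 - p (R j))) :=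
          mul_le_of_le_one_right (mul_nonneg h5 h1) h4
        rcases ho (R i) with ho' | ho'
        · have h7 := hgood i hi ho' (e k₀) (heD k₀) hk₀ hu' (d i) (hd2 i) (hle i hi)
          have := mul_le_mul_of_nonneg_right h7 h1
          linarith
        · have h7 : p (d i) - p (R i) ≤ 1 := by linarith [(hp (d i)).2, (hp (R i)).1]
          have h8 := mul_le_one₀ h7 h1 h2
          have := mul_nonneg (hψ (R i)) h1
          linarith
    have hosum : ∑ i, (if R i ∈ D then 0 else o (R i)) ≤ ∑ a ∈ Dᶜ, o a := by
      have h1 : ∑ i, (if R i ∈ D then 0 else o (R i)) =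
          ∑ a ∈ (Finset.univ.filter fun i => R i ∉ D).map R, o a := by
        rw [Finset.sum_map, Finset.sum_filter]
        exact Finset.sum_congr rfl fun i _ => by split_ifs <;> simp_all
      rw [h1]
      refine Finset.sum_le_sum_of_subset_of_nonneg ?_ fun a _ _ => ho0 a
      intro a ha
      obtain ⟨i, hi, rfl⟩ := Finset.mem_map.1 ha
      simpa using hi
    have := Finset.sum_le_sum fun i (_ : i ∈ Finset.univ) => hbound i
    rw [Finset.sum_add_distrib] at this
    linarith
  · set w := p (e k₀) * ∏ j with j < k₀, (1 - p (e j)) with hw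
    have hw0 : 0 ≤ w := mul_nonneg (hp _).1 (hprod0 _ _)
    have hbound : ∀ i, (p (d i) - p (R i)) * (∏ j with j < i, (1 - p (R j))) *
        ∏ j with i < j, (1 - p (d j)) ≤ if R i ∉ D then w else 0 := by
      intro i
      by_cases hi : R i ∈ D
      · simp [hi, hterm0 i hi]
      rw [if_pos hi]
      let c : Fin K → ℝ := fun j =>
        (if j < i then 1 - p (R j) else 1) * if i < j then 1 - p (d j) else 1
      have hc : (∏ j with j < i, (1 - p (R j))) * ∏ j with i < j, (1 - p (d j)) = ∏ j, c j := by
        simp only [c, Finset.prod_mul_distrib, Finset.prod_filter]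
      have hc0 : ∀ j, 0 ≤ c j := fun j =>
        mul_nonneg (by split_ifs; exacts [hq0 _, zero_le_one])
          (by split_ifs; exacts [hq0 _, zero_le_one])
      have hc1 : ∀ j, c j ≤ 1 := fun j =>
        mul_le_one₀ (by split_ifs; exacts [hq1 _, le_rfl])
          (by split_ifs; exacts [hq0 _, zero_le_one]) (by split_ifs; exacts [hq1 _, le_rfl])
      choose! g hg using hmin'
      -- Each `e k` with `k < k₀` occupies a position other than `i`. There `d` and `R` agree, so
      -- its factor occurs in the mixed product on either side of `i`.
      have hle2 : ∏ j, c j ≤ ∏ k with k < k₀, (1 - p (e k)) := by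
        refine prod_mul_prod_le_prod_of_injOn hc0 hc1 (g := g) ?_ ?_
        · intro k hk k' hk' hkk
          simp only [Finset.coe_filter, Finset.mem_univ, true_and, Set.mem_ofPred_eq] at hk hk'
          exact he (by rw [← hg k hk, ← hg k' hk', hkk])
        · intro k hk
          simp only [Finset.mem_filter, Finset.mem_univ, true_and] at hk
          have hgD : R (g k) ∈ D := by rw [hg k hk]; exact heD k
          have hne : g k ≠ i := fun h => hi (h ▸ hgD)
          rcases lt_or_gt_of_ne hne with h | h
          · simp [c, h, h.not_gt, hg k hk]
          · simp [c, h, h.not_gt, hd3 _ hgD, hg k hk]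
      rw [mul_assoc, hc, hw]
      exact mul_le_mul (by linarith [hle i hi, (hp (R i)).1]) hle2
        (Finset.prod_nonneg fun j _ => hc0 j) (hp _).1
    have h1 : ∑ i, (p (d i) - p (R i)) * (∏ j with j < i, (1 - p (R j))) *
        ∏ j with i < j, (1 - p (d j)) ≤ ((L : ℝ) - K) * w := by
      refine (Finset.sum_le_sum fun i _ => hbound i).trans ?_
      rw [← Finset.sum_filter, Finset.sum_const, nsmul_eq_mul]
      exact mul_le_mul_of_nonneg_right (card_list_sdiff_le hKL R hD.1) hw0
    have h2 : w ≤ ∑ k, u (e k) * (p (e k) * ∏ j with j < k, (1 - p (e j))) := by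
      have := Finset.single_le_sum (fun k _ => hS3t k) (Finset.mem_univ k₀)
      rwa [hu', one_mul] at this
    have := mul_le_mul_of_nonneg_left h2 hLK
    linarith

end

/-! ### Confidence radii and the regret of one step away from breakpoints. -/

section

variable {L K : ℕ}

theorem one_le_horizon {γ : ℝ} (hγ : 0 ≤ γ) (hγ1 : γ < 1) (t : ℕ) : 1 ≤ horizon γ (t + 1) := by
  have hx : 0 < 1 - γ := by linarith
  rw [horizon, le_div_iff₀ hx, pow_succ]
  have : γ ^ t * γ ≤ 1 * γ := mul_le_mul_of_nonneg_right (pow_le_one₀ hγ hγ1.le) hγ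
  linarith

/-- Bernoulli's inequality gives `γ^t ≤ 1/(1 + t(1-γ))`; this makes the failure probabilities
summable by harmonic sums. -/
theorem one_div_horizon_le {γ : ℝ} (hγ : 0 < γ) (hγ1 : γ < 1) {t : ℕ} (ht : 1 ≤ t) :
    1 / horizon γ t ≤ 1 / t + (1 - γ) := by
  have hx : 0 < 1 - γ := by linarith
  have ht0 : (0 : ℝ) < t := by exact_mod_cast ht
  have h1 : γ ^ t * (1 + t * (1 - γ)) ≤ 1 := by
    have h2 := one_add_mul_le_pow (a := 1 / γ - 1) (by have := one_div_pos.2 hγ; linarith) t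
    have h3 : 1 - γ ≤ 1 / γ - 1 := by
      have : 1 / γ - 1 - (1 - γ) = (1 - γ) ^ 2 / γ := by field_simp
      have : 0 ≤ (1 - γ) ^ 2 / γ := by positivity
      linarith
    have h4 : 1 + t * (1 - γ) ≤ (1 / γ) ^ t := by
      refine le_trans ?_ (h2.trans (le_of_eq (by congr 1; ring)))
      gcongr
    calc γ ^ t * (1 + t * (1 - γ)) ≤ γ ^ t * (1 / γ) ^ t := by gcongr
      _ = 1 := by rw [← mul_pow, mul_one_div_cancel hγ.ne', one_pow]
  have h5 : 0 < 1 - γ ^ t := by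
    have := pow_lt_one₀ hγ.le hγ1 (show t ≠ 0 by omega)
    linarith
  rw [horizon, one_div_div, div_add' _ _ _ ht0.ne', div_le_div_iff₀ h5 ht0]
  nlinarith

/-- The discounted click rate of an item differs from `p` by more than the confidence radius. -/
def RadiusFails (γ ε : ℝ) (p : Fin L → ℝ) (h : History L K) (a : Fin L) : Prop :=
  0 < discN γ h a ∧ 2 * √(ε * Real.log (horizon γ (h.length + 1)) / discN γ h a) <
    |discX γ h a / discN γ h a - p a|

theorem ucb_of_pos {γ ε : ℝ} {h : History L K} {a : Fin L} (hN : 0 < discN γ h a) :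
    ucb γ ε h a = discX γ h a / discN γ h a +
      2 * √(ε * Real.log (horizon γ (h.length + 1)) / discN γ h a) := by
  simp only [ucb, divOne, if_neg hN.ne']

theorem le_ucb {γ ε : ℝ} (hγ : 0 ≤ γ) {p : Fin L → ℝ} {h : History L K} {b : Fin L}
    (hp : p b ≤ 1) (hb : ¬ RadiusFails γ ε p h b) : p b ≤ ucb γ ε h b := by
  rcases (discN_nonneg hγ h b).eq_or_lt with hN | hN
  -- For an unobserved item the convention `x / 0 = 1` gives the index `1 + 2 = 3`.
  · simp only [ucb, divOne, if_pos hN.symm, Real.sqrt_one]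
    linarith
  · rw [ucb_of_pos hN]
    have h1 : ¬ _ := fun h1 => hb ⟨hN, h1⟩
    rw [not_lt, abs_le] at h1
    linarith [h1.1]

/-- For observed `a`, `p b ≤ U(b) ≤ U(a) ≤ p a + 4√(ε ln N_t / N(a))`, that is, `p a` plus twice the
radius. -/
theorem sq_gap_mul_discN_le {γ ε : ℝ} (hγ : 0 ≤ γ) (hγ1 : γ < 1) (hε : 0 ≤ ε) {p : Fin L → ℝ}
    {h : History L K} {a b : Fin L} (hp : p b ≤ 1) (ha : ¬ RadiusFails γ ε p h a)
    (hb : ¬ RadiusFails γ ε p h b) (hab : ucb γ ε h b ≤ ucb γ ε h a) {g : ℝ} (hg : 0 ≤ g)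
    (hg' : g ≤ p b - p a) :
    g ^ 2 * discN γ h a ≤ 16 * ε * Real.log (horizon γ (h.length + 1)) := by
  have hl : 0 ≤ Real.log (horizon γ (h.length + 1)) := Real.log_nonneg (one_le_horizon hγ hγ1 _)
  rcases (discN_nonneg hγ h a).eq_or_lt with hN | hN
  · rw [← hN, mul_zero]
    positivity
  · have h1 : ¬ _ := fun h1 => ha ⟨hN, h1⟩
    rw [not_lt, abs_le] at h1
    have h2 := le_ucb hγ hp hb
    rw [ucb_of_pos hN] at hab
    have h3 : g ≤ 4 * √(ε * Real.log (horizon γ (h.length + 1)) / discN γ h a) := by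
      linarith [h1.2]
    have h4 : g ^ 2 ≤ (4 * √(ε * Real.log (horizon γ (h.length + 1)) / discN γ h a)) ^ 2 := by
      gcongr
    rw [mul_pow, Real.sq_sqrt (by positivity)] at h4
    calc g ^ 2 * discN γ h a ≤ 4 ^ 2 * (ε * Real.log (horizon γ (h.length + 1)) / discN γ h a) *
          discN γ h a := by gcongr
      _ = _ := by field_simp; ring

/-- With `q = √(εlN)`, a failure means a total deviation above `2q`. The two bias bounds `N` and
`εl/4` multiply to `q²/4`, so the bias is at most `q/2` and noise of at least `3q/2` remains;
finally `9ε/4 ≥ 9/8`. -/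
theorem RadiusFails.deviation {γ ε : ℝ} (hε : 1 / 2 ≤ ε)
    {α : ℕ → Fin L → ℝ} {p : Fin L → ℝ} {h : History L K} {a : Fin L}
    (hl : 0 ≤ Real.log (horizon γ (h.length + 1)))
    (hb : |discMean γ α h a - p a * discN γ h a| ≤ discN γ h a)
    (hb' : |discMean γ α h a - p a * discN γ h a| ≤
      ε * Real.log (horizon γ (h.length + 1)) / 4)
    (hf : RadiusFails γ ε p h a) :
    9 / 8 * Real.log (horizon γ (h.length + 1)) * discN γ h a ≤
      (discX γ h a - discMean γ α h a) ^ 2 := by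
  obtain ⟨hN, hf⟩ := hf
  set N := discN γ h a
  set X := discX γ h a
  set B := discMean γ α h a
  set l := Real.log (horizon γ (h.length + 1))
  set q := √(ε * l * N) with hq
  have hq2 : q ^ 2 = ε * l * N := Real.sq_sqrt (by positivity)
  have hq0 : 0 ≤ q := Real.sqrt_nonneg _
  have h1 : 2 * q < |X - p a * N| := by
    have h2 : √(ε * l / N) * N = q := by
      rw [hq, show ε * l * N = ε * l / N * N ^ 2 by field_simp, Real.sqrt_mul (by positivity),
        Real.sqrt_sq hN.le]
    have h3 : |X / N - p a| * N = |X - p a * N| := by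
      rw [← abs_of_pos hN, ← abs_mul, abs_of_pos hN, sub_mul, div_mul_cancel₀ _ hN.ne']
    rw [← h2, ← h3]
    nlinarith
  have h4 : |B - p a * N| ≤ q / 2 := by
    refine abs_le_of_sq_le_sq' ?_ (by positivity) |> abs_le.2
    rw [div_pow, hq2, ← sq_abs]
    nlinarith [abs_nonneg (B - p a * N)]
  have h5 : 3 / 2 * q ≤ |X - B| := by
    have : |X - p a * N| ≤ |X - B| + |B - p a * N| := by
      have := abs_add_le (X - B) (B - p a * N)
      rwa [sub_add_sub_cancel] at this
    linarith
  have h6 : (3 / 2 * q) ^ 2 ≤ |X - B| ^ 2 := by gcongr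
  rw [mul_pow, hq2, sq_abs] at h6
  have : 0 ≤ l * N := by positivity
  nlinarith

variable {Ω : Type u} [MeasurableSpace Ω] {μ : Measure Ω} {n : ℕ}
  {α : ℕ → Fin L → ℝ} {A : ℕ → Ω → Fin L → Bool}

open Classical in
theorem IsEnvironment.integral_radiusFails_le [IsProbabilityMeasure μ] (hA : IsEnvironment μ n α A)
    (π : History L K → RankedList L K) {γ ε : ℝ} (hγ : 99 / 100 ≤ γ) (hγ1 : γ < 1)
    (hε : 1 / 2 ≤ ε) {W : ℕ} (hW : γ ^ W / (1 - γ) ≤ ε / 6) {t : ℕ} (ht : t + 1 ≤ n)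
    (a : Fin L) (hc : ∀ s, 1 ≤ s → s ≤ t → t < s + W → α s a = α (t + 1) a) :
    ∫ ω, (if RadiusFails γ ε (α (t + 1)) (hist π (fun s => A s ω) t) a then 1 else 0) ∂μ ≤
      4 * (1 / horizon γ (t + 1)) := by
  have hγ0 : 0 ≤ γ := by linarith
  have hh1 := one_le_horizon hγ0 hγ1 t
  have hexp : 1 / horizon γ (t + 1) = Real.exp (-Real.log (horizon γ (t + 1))) := by
    rw [Real.exp_neg, Real.exp_log (by linarith), one_div]
  rcases Nat.eq_zero_or_pos t with rfl | htpos
  · simp only [hist, RadiusFails, discN, lt_irrefl, false_and, if_false, integral_zero]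
    positivity
  -- From the second step on, the horizon is at least `1 + γ ≥ 1.99`. At the first step nothing has
  -- been observed, so no radius fails.
  have hl : 2 / 3 ≤ Real.log (horizon γ (t + 1)) := by
    have h2 : 199 / 100 ≤ horizon γ (t + 1) := by
      rw [horizon, le_div_iff₀ (by linarith)]
      have : γ ^ (t + 1) ≤ γ ^ 2 := pow_le_pow_of_le_one hγ0 hγ1.le (by omega)
      nlinarith
    have h3 : Real.log 2 + Real.log (199 / 200) ≤ Real.log (horizon γ (t + 1)) := by
      rw [← Real.log_mul (by norm_num) (by norm_num)]
      exact Real.log_le_log (by norm_num) (by linarith)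
    have h4 := Real.one_sub_inv_le_log_of_pos (show (0 : ℝ) < 199 / 200 by norm_num)
    have := Real.log_two_gt_d9
    norm_num at h4
    linarith
  rw [hexp]
  let P : History L K → Prop := fun h => h.length = t ∧ RadiusFails γ ε (α (t + 1)) h a
  have hPeq : ∀ ω, (if RadiusFails γ ε (α (t + 1)) (hist π (fun s => A s ω) t) a then (1 : ℝ)
      else 0) = if P (hist π (fun s => A s ω) t) then 1 else 0 := fun ω => by
    simp [P, length_hist]
  simp_rw [hPeq]
  refine hA.integral_deviation_le (t := t) π hγ0 hγ1 a (by omega) hl ?_ P ?_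
  · rw [Real.exp_log (by linarith)]
    unfold horizon
    have : γ ^ (t + 1) ≤ γ ^ t := pow_le_pow_of_le_one hγ0 hγ1.le (by omega)
    have : 0 < 1 - γ := by linarith
    gcongr
  · rintro h ⟨hlen, hf⟩
    have hα : ∀ s, 1 ≤ s → s ≤ h.length → 0 ≤ α s a ∧ α s a ≤ 1 := fun s hs hs' =>
      hA.mem_unitInterval (by simp only [Finset.mem_Icc]; omega) a
    obtain ⟨hp0, hp1⟩ := hA.mem_unitInterval (t := t + 1) (by simp [ht]) a
    refine ⟨hf.1, ?_⟩
    subst hlen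
    refine hf.deviation hε (by linarith) (abs_discMean_sub_le hγ0 h a hp0 hp1 hα) ?_
    refine (abs_discMean_sub_le_pow hγ0 hγ1 W h a hp0 hp1 hα hc).trans (hW.trans ?_)
    nlinarith

/-- The product over earlier positions is the probability of being examined, so the loss is charged
only when the item is observed and `N(a)` grows. -/
theorem sum_list_mul_prod_earlier_le {p : Fin L → ℝ} (hp : ∀ a, 0 ≤ p a ∧ p a ≤ 1)
    (R : RankedList L K) {ψ : Fin L → ℝ} (hψ : ∀ a, 0 ≤ ψ a) (D : Finset (Fin L)) :
    ∑ i, (if R i ∈ D then 0 else ψ (R i)) * ∏ j with j < i, (1 - p (R j)) ≤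
      ∑ v, bernWeight p v * ∑ a ∈ Dᶜ, examInd R (click R v) a * ψ a := by
  have h1 : ∀ v : Fin L → Bool, ∑ i, (if R i ∈ D then 0 else ψ (R i)) *
      examInd R (click R v) (R i) ≤ ∑ a ∈ Dᶜ, examInd R (click R v) a * ψ a := by
    intro v
    have h2 : ∑ i, (if R i ∈ D then 0 else ψ (R i)) * examInd R (click R v) (R i) =
        ∑ a ∈ (Finset.univ.filter fun i => R i ∉ D).map R, examInd R (click R v) a * ψ a := by
      rw [Finset.sum_map, Finset.sum_filter]
      exact Finset.sum_congr rfl fun i _ => by split_ifs <;> simp_all [mul_comm]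
    rw [h2]
    refine Finset.sum_le_sum_of_subset_of_nonneg ?_ fun a _ _ =>
      mul_nonneg (examInd_nonneg _ _ _) (hψ a)
    intro a ha
    obtain ⟨i, hi, rfl⟩ := Finset.mem_map.1 ha
    simpa using hi
  calc _ = ∑ v, bernWeight p v * ∑ i, (if R i ∈ D then 0 else ψ (R i)) *
        examInd R (click R v) (R i) := by
        simp_rw [← sum_bernWeight_examInd p R, Finset.mul_sum]
        rw [Finset.sum_comm]
        exact Finset.sum_congr rfl fun v _ => Finset.sum_congr rfl fun i _ => by ring
    _ ≤ _ := Finset.sum_le_sum fun v _ => mul_le_mul_of_nonneg_left (h1 v) (bernWeight_nonneg hp v)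

/-- The expected regret of one step is the mean of the loss of the displayed list. -/
theorem IsEnvironment.integral_regret_step [IsProbabilityMeasure μ] (hA : IsEnvironment μ n α A)
    (π : History L K → RankedList L K) {t : ℕ} (ht : t + 1 ≤ n) (m : ℝ) :
    ∫ ω, (m - reward (shown π (fun s => A s ω) (t + 1)) (toReal (A (t + 1) ω))) ∂μ =
      ∫ ω, (m - 1 + ∏ i, (1 - α (t + 1) (π (hist π (fun s => A s ω) t) i))) ∂μ := by
  refine (hA.integral_step π ht fun h v => m - reward (π h) (toReal v)).trans ?_
  congr 1 with ω
  simp only [reward]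
  rw [← sum_bernWeight_prod_list]
  have : ∀ v, bernWeight (α (t + 1)) v *
      (m - (1 - ∏ i, (1 - toReal v (π (hist π (fun s => A s ω) t) i)))) =
      bernWeight (α (t + 1)) v * (m - 1) + bernWeight (α (t + 1)) v *
        ∏ i, (1 - toReal v (π (hist π (fun s => A s ω) t) i)) := fun v => by ring
  simp_rw [this]
  rw [Finset.sum_add_distrib, ← Finset.sum_mul, sum_bernWeight, one_mul]

theorem IsEnvironment.regret_step_le [IsProbabilityMeasure μ] (hA : IsEnvironment μ n α A)
    (π : History L K → RankedList L K) {t : ℕ} (ht : t + 1 ≤ n) {D : Finset (Fin L)}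
    (hD : IsTopK K (α (t + 1)) D) {Q : History L K → ℝ}
    (hQ : ∀ h, h.length = t →
      ∏ i, (1 - α (t + 1) (π h i)) - ∏ a ∈ D, (1 - α (t + 1) a) ≤ Q h) :
    ∫ ω, ((⨆ R : RankedList L K, reward R (α (t + 1))) -
      reward (shown π (fun s => A s ω) (t + 1)) (toReal (A (t + 1) ω))) ∂μ ≤
      ∫ ω, Q (hist π (fun s => A s ω) t) ∂μ := by
  rw [hA.integral_regret_step π ht]
  refine integral_mono (hA.integrable_hist π (by omega) fun h => (⨆ R : RankedList L K,
    reward R (α (t + 1))) - 1 + ∏ i, (1 - α (t + 1) (π h i)))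
    (hA.integrable_hist π (by omega) Q) fun ω => ?_
  have h1 := iSup_reward_le (fun a => hA.mem_unitInterval (t := t + 1) (by simp [ht]) a) hD
    (π (hist π (fun s => A s ω) t))
  have h2 := hQ _ (length_hist π (fun s => A s ω) t)
  simp only
  linarith

-- The factor `2` counts the two kinds of failure: suboptimal items through a union bound over the
-- `L - K` of them, optimal items through weights of total mass at most `1`.
open Classical in
theorem IsEnvironment.regret_step_le_exam [IsProbabilityMeasure μ] (hKL : K ≤ L)
    (hA : IsEnvironment μ n α A) {π : History L K → RankedList L K} {γ ε : ℝ} (hγ : 1 / 2 ≤ γ)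
    (hγ1 : γ < 1) (hε : 0 < ε) (hπ : IsCascadeDUCB γ ε π) {t : ℕ} (ht : t + 1 ≤ n)
    {D : Finset (Fin L)} (hD : IsTopK K (α (t + 1)) D) {Δ : Fin L → ℝ}
    (hΔ : ∀ a ∉ D, ∀ b ∈ D, Δ a ≤ α (t + 1) b - α (t + 1) a)
    {q : ℝ} (hq0 : 0 ≤ q) (hq : ∀ a, ∫ ω, (if RadiusFails γ ε (α (t + 1)) (hist π (fun s => A s ω) t) a
      then 1 else 0) ∂μ ≤ q) :
    ∫ ω, ((⨆ R : RankedList L K, reward R (α (t + 1))) -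
      reward (shown π (fun s => A s ω) (t + 1)) (toReal (A (t + 1) ω))) ∂μ ≤
      ∫ ω, ∑ a ∈ Dᶜ, examAt π (fun s => A s ω) (t + 1) a *
        cutCap (16 * ε * Real.log (1 / (1 - γ))) (Δ a) (discN γ (hist π (fun s => A s ω) t) a) ∂μ +
        2 * ((L : ℝ) - K) * q := by
  have hγ0 : 0 ≤ γ := by linarith
  have hx : 0 < 1 - γ := by linarith
  have hp := fun a => hA.mem_unitInterval (t := t + 1) (by simp [ht]) a
  have hY : 0 < 16 * ε * Real.log (1 / (1 - γ)) := by
    have : 0 < Real.log (1 / (1 - γ)) := Real.log_pos (by rw [lt_div_iff₀ hx]; linarith)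
    positivity
  obtain ⟨e, he, heD, hDe, hanti⟩ := exists_antitone_enum (α (t + 1)) hD.1
  let f : Fin L → History L K → ℝ := fun a h => if RadiusFails γ ε (α (t + 1)) h a then 1 else 0
  let ψ : History L K → Fin L → ℝ := fun h a =>
    cutCap (16 * ε * Real.log (1 / (1 - γ))) (Δ a) (discN γ h a)
  let w : Fin K → ℝ := fun k => α (t + 1) (e k) * ∏ j with j < k, (1 - α (t + 1) (e j))
  have hw0 : ∀ k, 0 ≤ w k := fun k =>
    mul_nonneg (hp _).1 (Finset.prod_nonneg fun j _ => by linarith [(hp (e j)).2])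
  have hw1 : ∑ k, w k ≤ 1 := sum_mul_prod_earlier_le_one fun k => (hp (e k)).2
  let G : History L K → (Fin L → Bool) → ℝ := fun h v =>
    ∑ a ∈ Dᶜ, examInd (π h) (click (π h) v) a * ψ h a
  let T : History L K → ℝ := fun h => ∑ v, bernWeight (α (t + 1)) v * G h v
  have hLK : (0 : ℝ) ≤ (L : ℝ) - K := by
    have : (K : ℝ) ≤ L := by exact_mod_cast hKL
    linarith
  have hstep := hA.regret_step_le π ht hD
    (Q := fun h => T h + ∑ a ∈ Dᶜ, f a h + ((L : ℝ) - K) * ∑ k, f (e k) h * w k) ?_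
  · have hif : ∀ a, Integrable (fun ω => f a (hist π (fun s => A s ω) t)) μ := fun a =>
      hA.integrable_hist π (by omega) (f a)
    have hiT : Integrable (fun ω => T (hist π (fun s => A s ω) t)) μ :=
      hA.integrable_hist π (by omega) T
    have hi1 : Integrable (fun ω => ∑ a ∈ Dᶜ, f a (hist π (fun s => A s ω) t)) μ :=
      integrable_finsetSum _ fun a _ => hif a
    have hi2 : Integrable (fun ω => ∑ k, f (e k) (hist π (fun s => A s ω) t) * w k) μ :=
      integrable_finsetSum _ fun k _ => (hif _).mul_const _
    have hi3 : Integrable (fun ω => T (hist π (fun s => A s ω) t) +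
        ∑ a ∈ Dᶜ, f a (hist π (fun s => A s ω) t)) μ := hiT.add hi1
    refine hstep.trans ?_
    rw [integral_add hi3 (hi2.const_mul _), integral_add hiT hi1, integral_const_mul,
      integral_finsetSum _ fun a _ => hif a,
      integral_finsetSum _ fun k _ => (hif (e k)).mul_const (w k)]
    have h1 : ∫ ω, T (hist π (fun s => A s ω) t) ∂μ =
        ∫ ω, ∑ a ∈ Dᶜ, examAt π (fun s => A s ω) (t + 1) a * cutCap (16 * ε *
          Real.log (1 / (1 - γ))) (Δ a) (discN γ (hist π (fun s => A s ω) t) a) ∂μ :=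
      (hA.integral_step π ht G).symm
    have h2 : ∑ a ∈ Dᶜ, ∫ ω, f a (hist π (fun s => A s ω) t) ∂μ ≤ ((L : ℝ) - K) * q := by
      refine (Finset.sum_le_card_nsmul _ _ q fun a _ => hq a).trans (le_of_eq ?_)
      rw [Finset.card_compl, hD.1, Fintype.card_fin, nsmul_eq_mul, Nat.cast_sub hKL]
    have h3 : ∑ k, ∫ ω, f (e k) (hist π (fun s => A s ω) t) * w k ∂μ ≤ q := by
      calc _ ≤ ∑ k, q * w k := Finset.sum_le_sum fun k _ => by
            rw [integral_mul_const]
            exact mul_le_mul_of_nonneg_right (hq (e k)) (hw0 k)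
        _ = q * ∑ k, w k := (Finset.mul_sum _ _ _).symm
        _ ≤ q := mul_le_of_le_one_right hq0 hw1
    rw [h1]
    have := mul_le_mul_of_nonneg_left h3 hLK
    linarith
  · intro h hlen
    refine (prod_list_sub_prod_le hKL hp hD (π h) he heD hDe hanti (o := fun a => f a h)
      (u := fun a => f a h) (ψ := ψ h) ?_ ?_ ?_ ?_).trans ?_
    · intro a; simp only [f]; split_ifs <;> simp
    · intro a; simp only [f]; split_ifs <;> simp
    · exact fun a => cutCap_nonneg _ _ _
    · intro i hi ho b hb hbR hu b' hb' hbb'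
      have ho' : ¬ RadiusFails γ ε (α (t + 1)) h (π h i) := fun hf => by simp [f, hf] at ho
      have hu' : ¬ RadiusFails γ ε (α (t + 1)) h b := fun hf => by simp [f, hf] at hu
      have hucb : ucb γ ε h b ≤ ucb γ ε h (π h i) :=
        (hπ h).2 _ (by simp) b (by simpa using hbR)
      have h1 := sq_gap_mul_discN_le hγ0 hγ1 hε.le (hp b).2 ho' hu' hucb
        (g := α (t + 1) b' - α (t + 1) (π h i)) (by linarith [hD.2 b' hb' _ hi]) (by linarith)
      refine le_cutCap hY (hΔ _ hi b' hb') (by linarith [(hp b').2, (hp (π h i)).1])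
        (h1.trans ?_)
      have h2 := one_le_horizon hγ0 hγ1 h.length
      have h3 : Real.log (horizon γ (h.length + 1)) ≤ Real.log (1 / (1 - γ)) :=
        Real.log_le_log (by linarith) (horizon_le hγ0 hγ1 _)
      gcongr
    · gcongr
      exact sum_list_mul_prod_earlier_le hp (π h) (fun a => cutCap_nonneg _ _ _) D

end

/-! ### Summation over time. -/

section

variable {L K : ℕ}

theorem eq_of_no_change {β : Type*} {f : ℕ → β} {r t : ℕ} (hrt : r ≤ t)
    (h : ∀ u, r < u → u ≤ t → f u = f (u - 1)) : f r = f t := by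
  induction t, hrt using Nat.le_induction with
  | base => rfl
  | succ t hrt ih =>
    rw [ih fun u hu hu' => h u hu (by omega), h (t + 1) (by omega) le_rfl, Nat.add_sub_cancel]

open Classical in
/-- Steps at distance less than `W` after a breakpoint. -/
noncomputable def afterBreak (α : ℕ → Fin L → ℝ) (n W : ℕ) : Finset ℕ :=
  (Finset.Icc 1 n).filter fun t => ∃ s ∈ Finset.Icc 2 n, α s ≠ α (s - 1) ∧ s ≤ t ∧ t < s + W

theorem card_afterBreak_le (α : ℕ → Fin L → ℝ) (n W : ℕ) :
    (afterBreak α n W).card ≤ numBreaks α n * W := by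
  classical
  refine (Finset.card_le_card (t := ((Finset.Icc 2 n).filter fun t => α t ≠ α (t - 1)).biUnion
    fun s => Finset.Ico s (s + W)) ?_).trans ?_
  · intro t ht
    simp only [afterBreak, Finset.mem_filter] at ht
    obtain ⟨-, s, hs, hs', h1, h2⟩ := ht
    simp only [Finset.mem_biUnion, Finset.mem_filter, Finset.mem_Ico]
    exact ⟨s, ⟨hs, hs'⟩, h1, h2⟩
  · refine (Finset.card_biUnion_le_card_mul _ _ W fun s _ => by simp).trans (le_of_eq ?_)
    unfold numBreaks
    congr 2

theorem eq_of_notMem_afterBreak {α : ℕ → Fin L → ℝ} {n W t : ℕ} (ht : t + 1 ≤ n)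
    (h : t + 1 ∉ afterBreak α n W) {s : ℕ} (hs : 1 ≤ s) (hst : s ≤ t) (hW : t < s + W) :
    α s = α (t + 1) := by
  classical
  refine eq_of_no_change (by omega) fun u hu hu' => ?_
  by_contra hne
  refine h ?_
  simp only [afterBreak, Finset.mem_filter, Finset.mem_Icc]
  exact ⟨by omega, u, by omega, hne, by omega, by omega⟩

theorem rpow_inv_le_exp_neg_one {γ : ℝ} (hγ : 0 < γ) (hγ1 : γ < 1) :
    γ ^ (1 / (1 - γ)) ≤ Real.exp (-1) := by
  have hx : 0 < 1 - γ := by linarith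
  rw [Real.rpow_def_of_pos hγ, Real.exp_le_exp, mul_one_div, div_le_iff₀ hx]
  linarith [Real.log_le_sub_one_of_pos hγ]

/-- With `γ^d = (1-γ)ε`, the doubled exponent leaves a spare factor `1-γ ≤ 1/100`, which also
absorbs the loss of `γ` due to the floor. -/
theorem pow_floor_div_le {γ ε : ℝ} (hγ : 99 / 100 ≤ γ) (hγ1 : γ < 1) (hε : 0 < ε) (hε1 : ε < 1) :
    γ ^ ⌊2 * (Real.log ((1 - γ) * ε) / Real.log γ)⌋₊ / (1 - γ) ≤ ε / 6 := by
  have hx : 0 < 1 - γ := by linarith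
  have hγ0 : 0 < γ := by linarith
  have hxε : 0 < (1 - γ) * ε := by positivity
  have hlog : Real.log γ < 0 := Real.log_neg hγ0 hγ1
  set d := Real.log ((1 - γ) * ε) / Real.log γ with hd
  have h1 : γ ^ ⌊2 * d⌋₊ ≤ γ ^ (2 * d - 1) := by
    rw [← Real.rpow_natCast]
    refine Real.rpow_le_rpow_of_exponent_ge hγ0 hγ1.le ?_
    linarith [Nat.lt_floor_add_one (2 * d)]
  have h2 : γ ^ (2 * d - 1) = ((1 - γ) * ε) ^ 2 / γ := by
    rw [Real.rpow_sub_one hγ0.ne', mul_comm, Real.rpow_mul hγ0.le]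
    congr 1
    have : γ ^ d = (1 - γ) * ε := by
      rw [Real.rpow_def_of_pos hγ0, hd, mul_div_cancel₀ _ hlog.ne, Real.exp_log hxε]
    rw [this]
    exact_mod_cast rfl
  rw [div_le_iff₀ hx]
  refine h1.trans (h2.le.trans ?_)
  rw [div_le_iff₀ hγ0]
  have h3 : 0 ≤ ε * (1 - γ) * (γ / 6 - (1 - γ) * ε) := by
    have : (1 - γ) * ε ≤ 1 / 100 * 1 := by gcongr; linarith
    exact mul_nonneg (by positivity) (by linarith)
  nlinarith

theorem sum_one_div_add_le {x : ℝ} (hx : 0 < x) (hx1 : x < 1) {n : ℕ} (hn : 1 ≤ n) :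
    ∑ t ∈ Finset.Icc 1 n, (1 / (t : ℝ) + x) ≤
      ⌈(n : ℝ) * x⌉₊ * (Real.log (1 / x) + 2) := by
  have hn0 : (0 : ℝ) < n := by exact_mod_cast hn
  have h1 : ∑ t ∈ Finset.Icc 1 n, 1 / (t : ℝ) ≤ 1 + Real.log n := by
    have h := harmonic_le_one_add_log n
    rw [harmonic_eq_sum_Icc] at h
    push_cast at h
    simpa using h
  have h2 := Real.log_le_sub_one_of_pos (mul_pos hn0 hx)
  rw [Real.log_mul hn0.ne' hx.ne'] at h2
  have h3 : Real.log (1 / x) = -Real.log x := by rw [one_div, Real.log_inv]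
  have h4 : 0 ≤ Real.log (1 / x) := by
    rw [h3]; linarith [Real.log_neg hx hx1]
  have h5 : (n : ℝ) * x ≤ ⌈(n : ℝ) * x⌉₊ := Nat.le_ceil _
  have h6 : (1 : ℝ) ≤ ⌈(n : ℝ) * x⌉₊ := by
    have := Nat.one_le_ceil_iff.2 (mul_pos hn0 hx)
    exact_mod_cast this
  rw [Finset.sum_add_distrib, Finset.sum_const, Nat.card_Icc, Nat.add_sub_cancel, nsmul_eq_mul]
  nlinarith

theorem one_le_mul_log_inv {x : ℝ} (hx : 1 / 100 ≤ x) (hx1 : x ≤ 1 / 2) :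
    1 ≤ 43 * x * Real.log (1 / x) := by
  have h2 := Real.log_two_gt_d9
  have hx0 : 0 < x := by linarith
  rcases le_total x (1 / 16) with h | h
  · have h3 : Real.log (2 ^ 4) ≤ Real.log (1 / x) := by
      refine Real.log_le_log (by norm_num) ?_
      rw [le_div_iff₀ hx0]; linarith
    rw [Real.log_pow] at h3
    push_cast at h3
    nlinarith
  · have h3 : Real.log 2 ≤ Real.log (1 / x) := by
      refine Real.log_le_log (by norm_num) ?_
      rw [le_div_iff₀ hx0]; linarith
    nlinarith

variable {Ω : Type u} [MeasurableSpace Ω] {μ : Measure Ω} {n : ℕ}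
  {α : ℕ → Fin L → ℝ} {A : ℕ → Ω → Fin L → Bool}

theorem IsEnvironment.regret_step_le_one [IsProbabilityMeasure μ] (hA : IsEnvironment μ n α A)
    (π : History L K → RankedList L K) {t : ℕ} (ht : t + 1 ≤ n) {D : Finset (Fin L)}
    (hD : IsTopK K (α (t + 1)) D) :
    ∫ ω, ((⨆ R : RankedList L K, reward R (α (t + 1))) -
      reward (shown π (fun s => A s ω) (t + 1)) (toReal (A (t + 1) ω))) ∂μ ≤ 1 := by
  have hp := fun a => hA.mem_unitInterval (t := t + 1) (by simp [ht]) a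
  refine (hA.regret_step_le π ht hD (Q := fun _ => 1) fun h _ => ?_).trans (by simp)
  have h1 : ∏ i, (1 - α (t + 1) (π h i)) ≤ 1 :=
    Finset.prod_le_one (fun i _ => by linarith [(hp (π h i)).2]) fun i _ => by
      linarith [(hp (π h i)).1]
  have h2 : 0 ≤ ∏ a ∈ D, (1 - α (t + 1) a) :=
    Finset.prod_nonneg fun a _ => by linarith [(hp a).2]
  linarith

/-- Here every list shows exactly the items of `D t`, and their order does not affect the reward. -/
theorem IsEnvironment.regret_nonpos [IsProbabilityMeasure μ] (hA : IsEnvironment μ n α A)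
    (π : History L K → RankedList L K) {D : ℕ → Finset (Fin L)}
    (hD : ∀ t ∈ Finset.Icc 1 n, IsTopK K (α t) (D t)) (hK : K = 0 ∨ K = L) :
    regret μ α A π n ≤ 0 := by
  refine Finset.sum_nonpos fun t ht => ?_
  obtain ⟨s, rfl⟩ : ∃ s, t = s + 1 := ⟨t - 1, by simp only [Finset.mem_Icc] at ht; omega⟩
  have hDt := hD _ ht
  refine (hA.regret_step_le π (by simp only [Finset.mem_Icc] at ht; omega) hDt
    (Q := fun _ => 0) fun h _ => ?_).trans (by simp)
  rw [prod_eq_prod_of_injective (π h).injective hDt.1, sub_self]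
  rcases hK with rfl | rfl
  · exact fun i => i.elim0
  · intro i
    rw [(Finset.card_eq_iff_eq_univ _).1 (hDt.1.trans (Fintype.card_fin _).symm)]
    exact Finset.mem_univ _

theorem IsEnvironment.regret_le_card [IsProbabilityMeasure μ] (hA : IsEnvironment μ n α A)
    (π : History L K → RankedList L K) {D : ℕ → Finset (Fin L)}
    (hD : ∀ t ∈ Finset.Icc 1 n, IsTopK K (α t) (D t)) : regret μ α A π n ≤ n := by
  refine (Finset.sum_le_card_nsmul _ _ 1 fun t ht => ?_).trans (by simp)
  obtain ⟨s, rfl⟩ : ∃ s, t = s + 1 := ⟨t - 1, by simp only [Finset.mem_Icc] at ht; omega⟩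
  exact hA.regret_step_le_one π (by simp only [Finset.mem_Icc] at ht; omega) (hD _ ht)

/-- Regret bound for small `1 - γ`, before the choice of the length `W` of the periods after
breakpoints that are ignored. -/
theorem IsEnvironment.regret_le_of_window [IsProbabilityMeasure μ] (hKL : K ≤ L)
    (hA : IsEnvironment μ n α A) {π : History L K → RankedList L K} {γ ε : ℝ} (hγ : 99 / 100 ≤ γ)
    (hγ1 : γ < 1) (hε : 1 / 2 < ε) (hπ : IsCascadeDUCB γ ε π) {D : ℕ → Finset (Fin L)}
    (hD : ∀ t ∈ Finset.Icc 1 n, IsTopK K (α t) (D t)) (hn : 1 ≤ n) {W : ℕ}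
    (hW : γ ^ W / (1 - γ) ≤ ε / 6) {F : Finset (Fin L)} {Δ : Fin L → ℝ}
    (hF : ∀ t ∈ Finset.Icc 1 n, ∀ a ∉ D t, a ∈ F) (hΔ0 : ∀ a ∈ F, 0 < Δ a)
    (hΔ1 : ∀ a ∈ F, Δ a ≤ 1)
    (hΔ : ∀ t ∈ Finset.Icc 1 n, ∀ a ∉ D t, ∀ b ∈ D t, Δ a ≤ α t b - α t a) :
    regret μ α A π n ≤ numBreaks α n * W + ∑ a ∈ F, 32 * ε / (Δ a * γ ^ (1 / (1 - γ))) *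
      ⌈(n : ℝ) * (1 - γ)⌉₊ * Real.log (1 / (1 - γ)) := by
  classical
  have hγ0 : 0 < γ := by linarith
  have hx : 0 < 1 - γ := by linarith
  have hLK : (0 : ℝ) ≤ (L : ℝ) - K := by
    have : (K : ℝ) ≤ L := by exact_mod_cast hKL
    linarith
  have hlog : 2 ≤ Real.log (1 / (1 - γ)) := by
    have h3 : Real.log (2 ^ 4) ≤ Real.log (1 / (1 - γ)) := by
      refine Real.log_le_log (by norm_num) ?_
      rw [le_div_iff₀ hx]; linarith
    rw [Real.log_pow] at h3
    push_cast at h3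
    linarith [Real.log_two_gt_d9]
  set l := Real.log (1 / (1 - γ)) with hl
  set B := afterBreak α n W with hB
  set Y := 16 * ε * l with hY
  set c := γ ^ (1 / (1 - γ)) with hc
  have hc0 : 0 < c := by positivity
  have hY0 : 0 < Y := by positivity
  let T : Fin L → ℕ → (ℕ → Fin L → Bool) → ℝ := fun a t B =>
    examAt π B t a * cutCap Y (Δ a) (discN γ (hist π B (t - 1)) a)
  have hT0 : ∀ a t B, 0 ≤ T a t B := fun a t B =>
    mul_nonneg (examInd_nonneg _ _ _) (cutCap_nonneg _ _ _)
  have hTi : ∀ a, ∀ t ∈ Finset.Icc 1 n, Integrable (fun ω => T a t fun s => A s ω) μ := by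
    intro a t ht
    rw [Finset.mem_Icc] at ht
    refine hA.integrable (F := T a t) fun B B' h => ?_
    have h1 : hist π B (t - 1) = hist π B' (t - 1) :=
      hist_congr π fun s hs => h s (by simp only [Finset.mem_Icc] at hs ⊢; omega)
    simp only [T, examAt, shown, h1, h t (by simp only [Finset.mem_Icc]; omega)]
  have hstep : ∀ t ∈ Finset.Icc 1 n,
      ∫ ω, ((⨆ R : RankedList L K, reward R (α t)) -
        reward (shown π (fun s => A s ω) t) (toReal (A t ω))) ∂μ ≤
      (if t ∈ B then 1 else 0) + (∑ a ∈ F, ∫ ω, T a t (fun s => A s ω) ∂μ +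
        8 * ((L : ℝ) - K) * (1 / t + (1 - γ))) := by
    intro t ht
    have ht' := Finset.mem_Icc.1 ht
    have hI0 : 0 ≤ ∑ a ∈ F, ∫ ω, T a t (fun s => A s ω) ∂μ :=
      Finset.sum_nonneg fun a _ => integral_nonneg fun ω => hT0 a t _
    have hR0 : 0 ≤ 8 * ((L : ℝ) - K) * (1 / t + (1 - γ)) := by positivity
    obtain ⟨s, rfl⟩ : ∃ s, t = s + 1 := ⟨t - 1, by omega⟩
    by_cases htB : s + 1 ∈ B
    · rw [if_pos htB]
      linarith [hA.regret_step_le_one π ht'.2 (hD _ ht)]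
    · rw [if_neg htB, zero_add]
      have h1 := one_le_horizon hγ0.le hγ1 s
      refine (hA.regret_step_le_exam hKL (by linarith) hγ1 (by linarith) hπ ht'.2 (hD _ ht)
        (hΔ _ ht) (q := 4 * (1 / horizon γ (s + 1))) (by positivity) fun a =>
          hA.integral_radiusFails_le π hγ hγ1 hε.le hW ht'.2 a fun r hr hr' hr'' => by
            rw [eq_of_notMem_afterBreak ht'.2 htB hr hr' hr'']).trans ?_
      refine add_le_add ?_ ?_
      · rw [← integral_finsetSum _ fun a _ => hTi a _ ht]
        refine integral_mono
          (integrable_finsetSum _ fun a _ => hTi a _ ht)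
          (integrable_finsetSum _ fun a _ => hTi a _ ht) fun ω => ?_
        refine Finset.sum_le_sum_of_subset_of_nonneg ?_ fun a _ _ => hT0 a (s + 1) _
        intro a ha
        exact hF _ ht a (by simpa using ha)
      · have h2 := one_div_horizon_le hγ0 hγ1 ht'.1
        have := mul_le_mul_of_nonneg_left h2 (show 0 ≤ 8 * ((L : ℝ) - K) by positivity)
        linarith
  have hsum := Finset.sum_le_sum hstep
  rw [Finset.sum_add_distrib, Finset.sum_add_distrib, Finset.sum_comm, ← Finset.mul_sum] at hsum
  have h1 : ∑ t ∈ Finset.Icc 1 n, (if t ∈ B then (1 : ℝ) else 0) ≤ numBreaks α n * W := by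
    rw [Finset.sum_ite_mem, Finset.sum_const, nsmul_eq_mul, mul_one]
    have h2 : (Finset.Icc 1 n ∩ B).card ≤ numBreaks α n * W :=
      (Finset.card_le_card Finset.inter_subset_right).trans (card_afterBreak_le α n W)
    exact_mod_cast h2
  set m : ℝ := ((⌈(n : ℝ) * (1 - γ)⌉₊ : ℕ) : ℝ) with hm
  have hm0 : 0 ≤ m := Nat.cast_nonneg _
  have h2 : ∀ a ∈ F, ∑ t ∈ Finset.Icc 1 n, ∫ ω, T a t (fun s => A s ω) ∂μ ≤
      m * (2 * (Y / c) / Δ a - Y / c + 2) := by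
    intro a ha
    rw [← integral_finsetSum _ fun t ht => hTi a t ht]
    refine (integral_mono (integrable_finsetSum _ fun t ht => hTi a t ht) (integrable_const _)
      fun ω => sum_examAt_cutCap_le π (fun s => A s ω) hγ0 hγ1 n a hY0 (hΔ0 a ha)
        (hΔ1 a ha)).trans (by simp [hm, hc])
  have h3 := Finset.sum_le_sum h2
  have h4 := sum_one_div_add_le hx (by linarith : 1 - γ < 1) hn
  -- At least `L - K` items bring a saving `Y/c`, matching the factor `L - K` of the failure cost.
  have hcard : (L : ℝ) - K ≤ F.card := by
    have ht1 : 1 ∈ Finset.Icc 1 n := by simp [hn]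
    have h5 : (D 1)ᶜ.card ≤ F.card :=
      Finset.card_le_card fun a ha => hF 1 ht1 a (by simpa using ha)
    rw [Finset.card_compl, (hD 1 ht1).1, Fintype.card_fin] at h5
    rw [← Nat.cast_sub hKL]
    exact_mod_cast h5
  have hYc : 21 * l ≤ Y / c := by
    rw [le_div_iff₀ hc0]
    have h5 := rpow_inv_le_exp_neg_one hγ0 hγ1
    have h6 : Real.exp (-1) ≤ 8 / 21 := by
      rw [Real.exp_neg, inv_le_comm₀ (Real.exp_pos _) (by norm_num)]
      linarith [Real.exp_one_gt_d9]
    nlinarith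
  have h5 : ∀ a ∈ F, m * (2 * (Y / c) / Δ a - Y / c + 2) =
      32 * ε / (Δ a * c) * m * l - m * (Y / c - 2) := by
    intro a ha
    have := (hΔ0 a ha).ne'
    rw [hY]
    field_simp
    ring
  rw [Finset.sum_congr rfl h5, Finset.sum_sub_distrib, Finset.sum_const, nsmul_eq_mul] at h3
  -- The failures are paid by the savings: `21l - 2 ≥ 8(l + 2)` because `l ≥ 2`.
  have h6 : 8 * ((L : ℝ) - K) * (m * (l + 2)) ≤ F.card * (m * (Y / c - 2)) := by
    have h7 : m * (8 * (l + 2)) ≤ m * (Y / c - 2) := mul_le_mul_of_nonneg_left (by linarith) hm0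
    have h8 : ((L : ℝ) - K) * (m * (8 * (l + 2))) ≤ F.card * (m * (Y / c - 2)) :=
      mul_le_mul hcard h7 (by positivity) (by positivity)
    linarith
  have h7 := mul_le_mul_of_nonneg_left h4 (show 0 ≤ 8 * ((L : ℝ) - K) by positivity)
  have h8 : regret μ α A π n = ∑ t ∈ Finset.Icc 1 n,
      ∫ ω, ((⨆ R : RankedList L K, reward R (α t)) -
        reward (shown π (fun s => A s ω) t) (toReal (A t ω))) ∂μ := rfl
  rw [h8]
  linarith

theorem IsEnvironment.regret_le [IsProbabilityMeasure μ] (hK : 0 < K) (hKL : K < L)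
    (hA : IsEnvironment μ n α A) {π : History L K → RankedList L K} {γ ε : ℝ} (hγ : 1 / 2 < γ)
    (hγ1 : γ < 1) (hε : 1 / 2 < ε) (hε1 : ε < 1) (hπ : IsCascadeDUCB γ ε π)
    {D : ℕ → Finset (Fin L)}
    (hD : ∀ t ∈ Finset.Icc 1 n, IsTopK K (α t) (D t)) {F : Finset (Fin L)} {Δ : Fin L → ℝ}
    (hF : ∀ t ∈ Finset.Icc 1 n, ∀ a ∉ D t, a ∈ F) (hΔ0 : ∀ a ∈ F, 0 < Δ a)
    (hΔ1 : ∀ a ∈ F, Δ a ≤ 1)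
    (hΔ : ∀ t ∈ Finset.Icc 1 n, ∀ a ∉ D t, ∀ b ∈ D t, Δ a ≤ α t b - α t a) :
    regret μ α A π n ≤ L * numBreaks α n * (Real.log ((1 - γ) * ε) / Real.log γ) +
      ∑ a ∈ F, 32 * ε / (Δ a * γ ^ (1 / (1 - γ))) *
        ⌈(n : ℝ) * (1 - γ)⌉₊ * Real.log (1 / (1 - γ)) := by
  have hγ0 : 0 < γ := by linarith
  have hx : 0 < 1 - γ := by linarith
  have hlog : 0 < Real.log (1 / (1 - γ)) := Real.log_pos (by rw [lt_div_iff₀ hx]; linarith)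
  have hd : 0 ≤ Real.log ((1 - γ) * ε) / Real.log γ :=
    div_nonneg_of_nonpos (Real.log_nonpos (by positivity) (by nlinarith))
      (Real.log_nonpos hγ0.le hγ1.le)
  have hterm : ∀ a ∈ F, 0 ≤ 32 * ε / (Δ a * γ ^ (1 / (1 - γ))) *
        ⌈(n : ℝ) * (1 - γ)⌉₊ * Real.log (1 / (1 - γ)) := fun a ha => by
    have := hΔ0 a ha
    positivity
  rcases Nat.eq_zero_or_pos n with rfl | hn
  · refine le_trans (le_of_eq (by simp [regret])) (add_nonneg ?_ (Finset.sum_nonneg hterm))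
    positivity
  rcases le_or_gt (99 / 100) γ with hγ' | hγ'
  · refine (hA.regret_le_of_window hKL.le hγ' hγ1 hε hπ hD hn
      (pow_floor_div_le hγ' hγ1 (by linarith) hε1) hF hΔ0 hΔ1 hΔ).trans ?_
    refine add_le_add ?_ le_rfl
    have h1 := Nat.floor_le (mul_nonneg zero_le_two hd)
    have h2 : (2 : ℝ) ≤ L := by
      have : 2 ≤ L := by omega
      exact_mod_cast this
    calc _ ≤ (numBreaks α n : ℝ) * (2 * (Real.log ((1 - γ) * ε) / Real.log γ)) := by gcongr
      _ ≤ (numBreaks α n : ℝ) * (L * (Real.log ((1 - γ) * ε) / Real.log γ)) := by gcongr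
      _ = _ := by ring
  -- For `γ < 99/100` the term of one suboptimal item exceeds `n`: its coefficient is at least `16e
  -- > 43`, and `43 x ln(1/x) ≥ 1` for `x = 1-γ`.
  · obtain ⟨a, ha⟩ : ∃ a, a ∉ D 1 := by
      by_contra hall
      push Not at hall
      have h1 := (hD 1 (by simp; omega)).1
      rw [Finset.eq_univ_iff_forall.2 hall, Finset.card_univ, Fintype.card_fin] at h1
      omega
    have haF := hF 1 (by simp; omega) a ha
    refine (hA.regret_le_card π hD).trans ?_
    have h1 : (n : ℝ) ≤ 32 * ε / (Δ a * γ ^ (1 / (1 - γ))) *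
        ⌈(n : ℝ) * (1 - γ)⌉₊ * Real.log (1 / (1 - γ)) := by
      have h2 := one_le_mul_log_inv (x := 1 - γ) (by linarith) (by linarith)
      have h3 : 43 ≤ 32 * ε / (Δ a * γ ^ (1 / (1 - γ))) := by
        have h4 := hΔ0 a haF
        rw [le_div_iff₀ (by positivity)]
        have h5 : Δ a * γ ^ (1 / (1 - γ)) ≤ 1 * (16 / 43) := by
          refine mul_le_mul (hΔ1 a haF) ((rpow_inv_le_exp_neg_one hγ0 hγ1).trans ?_)
            (by positivity) zero_le_one
          rw [Real.exp_neg, inv_le_comm₀ (Real.exp_pos _) (by norm_num)]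
          linarith [Real.exp_one_gt_d9]
        linarith
      calc (n : ℝ) ≤ n * (43 * (1 - γ) * Real.log (1 / (1 - γ))) :=
            le_mul_of_one_le_right (by positivity) h2
        _ = 43 * (n * (1 - γ)) * Real.log (1 / (1 - γ)) := by ring
        _ ≤ _ := by
          gcongr
          exact Nat.le_ceil _
    have h2 := Finset.single_le_sum hterm haF
    have h3 : 0 ≤ (L : ℝ) * numBreaks α n * (Real.log ((1 - γ) * ε) / Real.log γ) := by positivity
    linarith

end

/-! ### Extended gaps, and the choice of `γ` in part (ii). -/

section

variable {L K : ℕ}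

theorem gap_le {α : ℕ → Fin L → ℝ} {D : ℕ → Finset (Fin L)} {n t : ℕ} (ht : t ∈ Finset.Icc 1 n)
    {a b : Fin L} (ha : a ∉ D t) (hb : b ∈ D t) :
    gap α D n a ≤ ENNReal.ofReal (α t b - α t a) :=
  (iInf₂_le t ht).trans ((iInf_le _ ha).trans (iInf₂_le b hb))

theorem constC_mul_eq_top {ε γ : ℝ} (hε : 0 < ε) (hγ : 1 / 2 < γ) (hγ1 : γ < 1) {n : ℕ}
    (hn : 1 ≤ n) :
    constC ε γ 0 * ((⌈(n : ℝ) * (1 - γ)⌉₊ : ℕ) : ℝ≥0∞) *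
      ENNReal.ofReal (Real.log (1 / (1 - γ))) = ⊤ := by
  have hx : 0 < 1 - γ := by linarith
  have hn0 : (0 : ℝ) < n := by exact_mod_cast hn
  have h1 : constC ε γ 0 = ⊤ := by
    rw [constC, zero_mul, ENNReal.div_zero, add_top]
    simpa using hε
  have h2 : ((⌈(n : ℝ) * (1 - γ)⌉₊ : ℕ) : ℝ≥0∞) ≠ 0 := by
    have := Nat.one_le_ceil_iff.2 (mul_pos hn0 hx)
    exact_mod_cast (by omega : ⌈(n : ℝ) * (1 - γ)⌉₊ ≠ 0)
  have h3 : ENNReal.ofReal (Real.log (1 / (1 - γ))) ≠ 0 := by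
    rw [ne_eq, ENNReal.ofReal_eq_zero, not_le]
    exact Real.log_pos (by rw [lt_div_iff₀ hx]; linarith)
  rw [h1, ENNReal.top_mul h2, ENNReal.top_mul h3]

theorem ofReal_le_constC_mul {ε γ Δ : ℝ} (hγ : 0 < γ) (hε : 0 ≤ ε) (hΔ : 0 < Δ) (m : ℕ)
    (l : ℝ) :
    ENNReal.ofReal (32 * ε / (Δ * γ ^ (1 / (1 - γ))) * m * l) ≤
      constC ε γ (ENNReal.ofReal Δ) * (m : ℝ≥0∞) * ENNReal.ofReal l := by
  rw [ENNReal.ofReal_mul (by positivity), ENNReal.ofReal_mul (by positivity),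
    ENNReal.ofReal_natCast, ENNReal.ofReal_div_of_pos (by positivity), ENNReal.ofReal_mul hΔ.le]
  gcongr
  -- The logarithmic summand of `constC` is discarded.
  exact le_add_self

variable {Ω : Type u} [MeasurableSpace Ω] {μ : Measure Ω} {n : ℕ}
  {α : ℕ → Fin L → ℝ} {A : ℕ → Ω → Fin L → Bool}

theorem IsEnvironment.ofReal_regret_le [IsProbabilityMeasure μ] (hKL : K ≤ L)
    (hA : IsEnvironment μ n α A) {π : History L K → RankedList L K} {γ ε : ℝ} (hγ : 1 / 2 < γ)
    (hγ1 : γ < 1) (hε : 1 / 2 < ε) (hε1 : ε < 1) (hπ : IsCascadeDUCB γ ε π)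
    {D : ℕ → Finset (Fin L)} (hD : ∀ t ∈ Finset.Icc 1 n, IsTopK K (α t) (D t)) :
    ENNReal.ofReal (regret μ α A π n) ≤
      ENNReal.ofReal (L * numBreaks α n * (Real.log ((1 - γ) * ε) / Real.log γ)) +
        ∑ a : Fin L, constC ε γ (gap α D n a) * ((⌈(n : ℝ) * (1 - γ)⌉₊ : ℕ) : ℝ≥0∞) *
          ENNReal.ofReal (Real.log (1 / (1 - γ))) := by
  classical
  by_cases hK : K = 0 ∨ K = L
  · rw [ENNReal.ofReal_of_nonpos (hA.regret_nonpos π hD hK)]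
    exact zero_le
  push Not at hK
  have hK0 : 0 < K := Nat.pos_of_ne_zero hK.1
  have hKL' : K < L := lt_of_le_of_ne hKL hK.2
  let F : Finset (Fin L) := Finset.univ.filter fun a => ∃ t ∈ Finset.Icc 1 n, a ∉ D t
  have hFmem : ∀ {a}, a ∈ F ↔ ∃ t ∈ Finset.Icc 1 n, a ∉ D t := by simp [F]
  -- A zero gap makes the bound infinite: an item of `F` exists only if `n ≥ 1`, so no `0 · ∞`
  -- arises.
  by_cases h0 : ∃ a ∈ F, gap α D n a = 0
  · obtain ⟨a, ha, ha0⟩ := h0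
    obtain ⟨t, ht, -⟩ := hFmem.1 ha
    have hn : 1 ≤ n := by rw [Finset.mem_Icc] at ht; omega
    rw [ENNReal.sum_eq_top.2 ⟨a, Finset.mem_univ a, by
      rw [ha0, constC_mul_eq_top (by linarith) hγ hγ1 hn]⟩, add_top]
    exact le_top
  push Not at h0
  have hgap1 : ∀ a ∈ F, gap α D n a ≤ 1 := by
    intro a ha
    obtain ⟨t, ht, hat⟩ := hFmem.1 ha
    obtain ⟨b, hb⟩ : (D t).Nonempty := Finset.card_pos.1 (by rw [(hD t ht).1]; exact hK0)
    refine (gap_le ht hat hb).trans (ENNReal.ofReal_le_one.2 ?_)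
    linarith [(hA.mem_unitInterval ht b).2, (hA.mem_unitInterval ht a).1]
  have hgapt : ∀ a ∈ F, gap α D n a ≠ ⊤ := fun a ha =>
    ((hgap1 a ha).trans_lt ENNReal.one_lt_top).ne
  have hmain := hA.regret_le hK0 hKL' hγ hγ1 hε hε1 hπ hD (F := F)
    (Δ := fun a => (gap α D n a).toReal) (fun t ht a ha => hFmem.2 ⟨t, ht, ha⟩)
    (fun a ha => ENNReal.toReal_pos (h0 a ha) (hgapt a ha))
    (fun a ha => by simpa using ENNReal.toReal_mono ENNReal.one_ne_top (hgap1 a ha))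
    (fun t ht a ha b hb => ENNReal.toReal_le_of_le_ofReal
      (by linarith [(hD t ht).2 b hb a ha]) (gap_le ht ha hb))
  refine (ENNReal.ofReal_le_ofReal hmain).trans (ENNReal.ofReal_add_le.trans ?_)
  gcongr
  have hx : 0 < 1 - γ := by linarith
  have hlog : 0 ≤ Real.log (1 / (1 - γ)) := Real.log_nonneg (by rw [le_div_iff₀ hx]; linarith)
  rw [ENNReal.ofReal_sum_of_nonneg fun a _ => by positivity]
  refine (Finset.sum_le_sum fun a ha => ?_).trans
    (Finset.sum_le_sum_of_subset_of_nonneg (Finset.subset_univ F) fun a _ _ => zero_le)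
  have h1 := ofReal_le_constC_mul (γ := γ) (ε := ε) (by linarith) (by linarith)
    (ENNReal.toReal_pos (h0 a ha) (hgapt a ha)) ⌈(n : ℝ) * (1 - γ)⌉₊ (Real.log (1 / (1 - γ)))
  rwa [ENNReal.ofReal_toReal (hgapt a ha)] at h1

theorem exp_neg_two_le_rpow {γ : ℝ} (hγ : 1 / 2 < γ) (hγ1 : γ < 1) :
    Real.exp (-2) ≤ γ ^ (1 / (1 - γ)) := by
  have hx : 0 < 1 - γ := by linarith
  have hγ0 : 0 < γ := by linarith
  rw [Real.rpow_def_of_pos hγ0, Real.exp_le_exp, mul_one_div, le_div_iff₀ hx]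
  have h1 := Real.one_sub_inv_le_log_of_pos hγ0
  have h2 : γ⁻¹ - 1 ≤ 2 * (1 - γ) := by
    rw [show γ⁻¹ - 1 = (1 - γ) / γ by field_simp, div_le_iff₀ hγ0]
    nlinarith
  linarith

theorem IsEnvironment.regret_le_sqrt [IsProbabilityMeasure μ] (hKL : K ≤ L)
    (hA : IsEnvironment μ n α A) {π : History L K → RankedList L K} {ε δ : ℝ}
    (hε : 1 / 2 < ε) (hε1 : ε < 1) (hδ : 0 < δ) {D : ℕ → Finset (Fin L)}
    (hD : ∀ t ∈ Finset.Icc 1 n, IsTopK K (α t) (D t))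
    (hgap : ∀ a : Fin L, ENNReal.ofReal δ ≤ gap α D n a) (hΥ : 1 ≤ numBreaks α n)
    (hπ : IsCascadeDUCB (1 - 1 / 4 * √((numBreaks α n : ℝ) / n)) ε π) :
    regret μ α A π n ≤ (16 * L + 192 * L * (Real.exp 2 / min δ 1)) *
      √((n : ℝ) * numBreaks α n) * Real.log n := by
  have hδ' : 0 < min δ 1 := lt_min hδ one_pos
  have hΥn : numBreaks α n + 1 ≤ n := by
    have : numBreaks α n ≤ n + 1 - 2 := (Finset.card_filter_le _ _).trans (by simp)
    omega
  have hlogn : 0 ≤ Real.log n := Real.log_natCast_nonneg n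
  by_cases hK : K = 0 ∨ K = L
  · refine (hA.regret_nonpos π hD hK).trans ?_
    positivity
  push Not at hK
  set Υ : ℝ := (numBreaks α n : ℝ) with hΥdef
  have hΥ1 : 1 ≤ Υ := by rw [hΥdef]; exact_mod_cast hΥ
  have hΥn' : Υ ≤ n := by
    have : numBreaks α n ≤ n := by omega
    rw [hΥdef]; exact_mod_cast this
  have hn0 : (0 : ℝ) < n := by linarith
  have hn2 : (2 : ℝ) ≤ n := by
    have : 2 ≤ n := by omega
    exact_mod_cast this
  set x := 1 / 4 * √(Υ / n) with hx
  set S := √((n : ℝ) * Υ) with hS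
  have hx0 : 0 < x := by positivity
  have hx4 : x ≤ 1 / 4 := by
    have : √(Υ / n) ≤ 1 := Real.sqrt_le_one.2 ((div_le_one hn0).2 hΥn')
    linarith
  -- With `x = 1-γ`, both `n x` and `Υ/x` are multiples of `S = √(nΥ)`, which balances the two terms
  -- of the bound.
  have hnx : n * x = S / 4 := by
    have : √((n : ℝ) * Υ) = n * √(Υ / n) := by
      rw [show (n : ℝ) * Υ = n ^ 2 * (Υ / n) by field_simp, Real.sqrt_mul (by positivity),
        Real.sqrt_sq hn0.le]
    rw [hS, this, hx]
    ring
  have hSx : Υ = 4 * S * x := by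
    have h1 : √((n : ℝ) * Υ) * √(Υ / n) = Υ := by
      rw [← Real.sqrt_mul (by positivity), show (n : ℝ) * Υ * (Υ / n) = Υ ^ 2 by field_simp,
        Real.sqrt_sq (by linarith)]
    rw [hS, hx]
    linarith
  have hS1 : 1 ≤ S := by
    rw [hS, Real.one_le_sqrt]
    nlinarith
  have hinv : 1 ≤ 4 * n * x := by linarith
  have hlog2 : Real.log 2 ≤ Real.log n := Real.log_le_log (by norm_num) hn2
  have hlogx : Real.log (1 / x) ≤ 3 * Real.log n := by
    have h1 : Real.log (1 / x) ≤ Real.log (2 ^ 2 * n) := by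
      refine Real.log_le_log (by positivity) ?_
      rw [div_le_iff₀ hx0]
      linarith
    rw [Real.log_mul (by norm_num) hn0.ne', Real.log_pow] at h1
    push_cast at h1
    linarith
  have hlogε : -Real.log (x * ε) ≤ 4 * Real.log n := by
    have h1 : -Real.log ε ≤ Real.log 2 := by
      rw [← Real.log_inv]
      refine Real.log_le_log (by positivity) ?_
      rw [inv_le_comm₀ (by positivity) (by norm_num)]
      linarith
    rw [Real.log_mul hx0.ne' (by positivity)]
    rw [one_div, Real.log_inv] at hlogx
    linarith
  have hγ : 1 / 2 < 1 - x := by linarith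
  have hγ1 : 1 - x < 1 := by linarith
  have hmain := hA.regret_le (Nat.pos_of_ne_zero hK.1) (lt_of_le_of_ne hKL hK.2) hγ hγ1 hε hε1 hπ hD
    -- The minimum with `1` keeps the gap parameter at most `1`, as `regret_le` requires.
    (F := Finset.univ) (Δ := fun _ => min δ 1) (fun _ _ a _ => Finset.mem_univ a)
    (fun _ _ => hδ') (fun _ _ => min_le_right _ _) (fun t ht a ha b hb => by
      have h1 := (hgap a).trans (gap_le ht ha hb)
      have h2 : 0 ≤ α t b - α t a := by linarith [(hD t ht).2 b hb a ha]
      exact (min_le_left _ _).trans ((ENNReal.ofReal_le_ofReal_iff h2).1 h1))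
  rw [sub_sub_cancel, Finset.sum_const, Finset.card_univ, Fintype.card_fin, nsmul_eq_mul] at hmain
  refine hmain.trans ?_
  have hfirst : L * Υ * (Real.log (x * ε) / Real.log (1 - x)) ≤ 16 * L * S * Real.log n := by
    have h1 : Real.log (x * ε) / Real.log (1 - x) ≤ 4 * Real.log n / x := by
      rw [← neg_div_neg_eq]
      have h2 := Real.log_le_sub_one_of_pos (show 0 < 1 - x by linarith)
      exact div_le_div₀ (by positivity) hlogε hx0 (by linarith)
    calc _ ≤ L * Υ * (4 * Real.log n / x) := by gcongr
      _ = _ := by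
        rw [hSx]
        field_simp
        ring
  have hexp := exp_neg_two_le_rpow hγ hγ1
  rw [sub_sub_cancel] at hexp
  have hsecond : 32 * ε / (min δ 1 * (1 - x) ^ (1 / x)) * ⌈(n : ℝ) * x⌉₊ * Real.log (1 / x) ≤
      192 * (Real.exp 2 / min δ 1) * S * Real.log n := by
    have h1 : 32 * ε / (min δ 1 * (1 - x) ^ (1 / x)) ≤ 32 * (Real.exp 2 / min δ 1) := by
      calc _ ≤ 32 * 1 / (min δ 1 * Real.exp (-2)) := by gcongr
        _ = _ := by rw [Real.exp_neg]; field_simp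
    have h2 : (⌈(n : ℝ) * x⌉₊ : ℝ) ≤ 2 * S := by
      have := Nat.ceil_lt_add_one (show 0 ≤ (n : ℝ) * x by positivity)
      linarith
    calc _ ≤ 32 * (Real.exp 2 / min δ 1) * (2 * S) * (3 * Real.log n) := by
          have h3 : 0 ≤ Real.log (1 / x) := Real.log_nonneg (by rw [le_div_iff₀ hx0]; linarith)
          gcongr
      _ = _ := by ring
  have := mul_le_mul_of_nonneg_left hsecond (show (0 : ℝ) ≤ L by positivity)
  linarith

end

end CascadeBandit

theorem theorem1 {L K : ℕ} (hKL : K ≤ L) (ε : ℝ) (hε : 1 / 2 < ε) (hε1 : ε < 1) :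
    (∀ (γ : ℝ), 1 / 2 < γ → γ < 1 →
      ∀ (Ω : Type u) [MeasurableSpace Ω] (μ : Measure Ω) [IsProbabilityMeasure μ]
        (n : ℕ) (α : ℕ → Fin L → ℝ) (A : ℕ → Ω → Fin L → Bool) (D : ℕ → Finset (Fin L))
        (π : CascadeBandit.History L K → CascadeBandit.RankedList L K),
        CascadeBandit.IsEnvironment μ n α A →
        (∀ t ∈ Finset.Icc 1 n, CascadeBandit.IsTopK K (α t) (D t)) →
        CascadeBandit.IsCascadeDUCB γ ε π →
        ENNReal.ofReal (CascadeBandit.regret μ α A π n) ≤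
          ENNReal.ofReal (L * CascadeBandit.numBreaks α n *
            (Real.log ((1 - γ) * ε) / Real.log γ)) +
          ∑ a : Fin L, CascadeBandit.constC ε γ (CascadeBandit.gap α D n a) *
            ((⌈(n : ℝ) * (1 - γ)⌉₊ : ℕ) : ℝ≥0∞) * ENNReal.ofReal (Real.log (1 / (1 - γ)))) ∧
    (∀ δ : ℝ, 0 < δ → ∃ c : ℝ,
      ∀ (Ω : Type u) [MeasurableSpace Ω] (μ : Measure Ω) [IsProbabilityMeasure μ]
        (n : ℕ) (α : ℕ → Fin L → ℝ) (A : ℕ → Ω → Fin L → Bool) (D : ℕ → Finset (Fin L))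
        (π : CascadeBandit.History L K → CascadeBandit.RankedList L K),
        CascadeBandit.IsEnvironment μ n α A →
        (∀ t ∈ Finset.Icc 1 n, CascadeBandit.IsTopK K (α t) (D t)) →
        (∀ a : Fin L, ENNReal.ofReal δ ≤ CascadeBandit.gap α D n a) →
        1 ≤ CascadeBandit.numBreaks α n →
        CascadeBandit.IsCascadeDUCB
          (1 - 1 / 4 * √((CascadeBandit.numBreaks α n : ℝ) / n)) ε π →
        CascadeBandit.regret μ α A π n ≤
          c * √((n : ℝ) * CascadeBandit.numBreaks α n) * Real.log n) := by
  refine ⟨?_, ?_⟩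
  · intro γ hγ hγ1 Ω _ μ _ n α A D π hA hD hπ
    exact hA.ofReal_regret_le hKL hγ hγ1 hε hε1 hπ hD
  · intro δ hδ
    refine ⟨16 * L + 192 * L * (Real.exp 2 / min δ 1), ?_⟩
    intro Ω _ μ _ n α A D π hA hD hgap hΥ hπ
    exact hA.regret_le_sqrt hKL hε hε1 hδ hD hgap hΥ hπ
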